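/- Let $\mathbb G=(\mathbb R^n,\circ,\delta_\lambda)$ be a stratified Lie group (homogeneous Carnot group): $\circ$ is a Lie group law on $\mathbb R^n$ with neutral element $0$; the coordinates carry degrees $d_1,\dots,d_n\in\{1,2,\dots\}$ such that the dilations $\delta_\lambda(x)=(\lambda^{d_1}x_1,\dots,\lambda^{d_n}x_n)$, $\lambda>0$, are group automorphisms; and the left-invariant vector fields $X_k$ with $X_k(0)=\partial_{x_k}|_0$, $d_k=1$, together with their iterated commutators, span $\mathbb R^n$ at every point. Let $\mathcal L=\sum_{d_k=1}X_k^2$ be the sub-Laplacian, and let $L^p(\Omega)$ refer to the Lebesgue measure. Let $\Omega\subset\mathbb G$ be an open set and $\sigma>1$. Let $V\in C(\Omega)$ be real-valued with $V>0$ on $\Omega$, such that the distribution $\mathcal L V$ on $\Omega$ is a locally integrable function, $\mathcal L V<0$ almost everywhere on $\Omega$, and $\mathcal L(V^\sigma)\le 0$ on $\Omega$ in the sense of distributions. Then for every complex-valued $u\in C_0^\infty(\Omega)$ and every $1\le p<\infty$, $$\left\|\,|\mathcal L V|^{\frac1p}u\right\|_{L^p(\Omega)}\le\frac{p^2}{(p-1)\sigma+1}\left\|\frac{V}{|\mathcal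 L V|^{\frac{p-1}{p}}}\,\mathcal L u\right\|_{L^p(\Omega)},$$ where the right-hand side may be $+\infty$. -/

import Mathlib

open MeasureTheory
open scoped ContDiff

noncomputable section

/-- The vector fields obtained from a set `S` of vector fields on `ℝⁿ` by iterated Lie brackets.
Their real linear span is the Lie algebra generated by `S`. -/
inductive IteratedBracket {n : ℕ} (S : Set ((Fin n → ℝ) → (Fin n → ℝ))) :
    ((Fin n → ℝ) → (Fin n → ℝ)) → Prop
  | of (Y : (Fin n → ℝ) → (Fin n → ℝ)) (hY : Y ∈ S) : IteratedBracket S Y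
  | bracket (Y Z : (Fin n → ℝ) → (Fin n → ℝ)) (hY : IteratedBracket S Y)
      (hZ : IteratedBracket S Z) : IteratedBracket S (VectorField.lieBracket ℝ Y Z)

/-- The dilation `δ_t(x) = (t ^ deg i * x i)_i`. -/
def dilation {n : ℕ} (deg : Fin n → ℕ) (t : ℝ) (x : Fin n → ℝ) : Fin n → ℝ :=
  fun i => t ^ deg i * x i

/-- For a group law `mul` on `ℝⁿ` with neutral element `0`, the left-invariant vector field
that equals `∂ / ∂x_i` at `0`; it is the `i`-th column of the Jacobian of `y ↦ x ∘ y` at `0`. -/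
def jacobianField {n : ℕ} (mul : (Fin n → ℝ) → (Fin n → ℝ) → (Fin n → ℝ)) (i : Fin n)
    (x : Fin n → ℝ) : Fin n → ℝ :=
  fderiv ℝ (fun y => mul x y) 0 (Pi.single i 1)

/-- A stratified Lie group in the form of a homogeneous Carnot group `(ℝⁿ, ∘, δ_t)`: a Lie group
law on `ℝⁿ` with neutral element `0`, whose automorphisms include the dilations `δ_t`, `t > 0`,
and whose Jacobian generators of degree one generate, together with their iterated brackets,
every tangent space. The coordinates of degree `l` are those of the `l`-th stratum. -/
structure CarnotGroup (n : ℕ) where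
  deg : Fin n → ℕ
  deg_pos : ∀ i, 1 ≤ deg i
  mul : (Fin n → ℝ) → (Fin n → ℝ) → (Fin n → ℝ)
  inv : (Fin n → ℝ) → (Fin n → ℝ)
  mul_assoc : ∀ x y z, mul (mul x y) z = mul x (mul y z)
  zero_mul : ∀ x, mul 0 x = x
  mul_zero : ∀ x, mul x 0 = x
  inv_mul : ∀ x, mul (inv x) x = 0
  mul_inv : ∀ x, mul x (inv x) = 0
  contDiff_mul : ContDiff ℝ ∞ (fun z : (Fin n → ℝ) × (Fin n → ℝ) => mul z.1 z.2)
  contDiff_inv : ContDiff ℝ ∞ inv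
  dilation_mul : ∀ t : ℝ, 0 < t → ∀ x y,
    dilation deg t (mul x y) = mul (dilation deg t x) (dilation deg t y)
  generates : ∀ x, Submodule.span ℝ
    {v | ∃ Y, IteratedBracket {Z | ∃ i, deg i = 1 ∧ Z = jacobianField mul i} Y ∧ v = Y x} = ⊤

namespace CarnotGroup

variable {n : ℕ} (G : CarnotGroup n)

/-- The derivative `X_i f` of a function along the `i`-th Jacobian generator. -/
def X {F : Type*} [NormedAddCommGroup F] [NormedSpace ℝ F] (i : Fin n) (f : (Fin n → ℝ) → F) :
    (Fin n → ℝ) → F :=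
  fun x => fderiv ℝ f x (jacobianField G.mul i x)

/-- The sub-Laplacian `𝓛 = ∑ X_k ^ 2`, the sum being over the first stratum. -/
def subLaplacian {F : Type*} [NormedAddCommGroup F] [NormedSpace ℝ F] (f : (Fin n → ℝ) → F) :
    (Fin n → ℝ) → F :=
  fun x => ∑ i with G.deg i = 1, G.X i (G.X i f) x

end CarnotGroup

/-- `φ ∈ C₀^∞(Ω)`. -/
structure IsTestFunction {n : ℕ} {F : Type*} [NormedAddCommGroup F] [NormedSpace ℝ F]
    (Ω : Set (Fin n → ℝ)) (φ : (Fin n → ℝ) → F) : Prop where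
  contDiff : ContDiff ℝ ∞ φ
  hasCompactSupport : HasCompactSupport φ
  tsupport_subset : tsupport φ ⊆ Ω

namespace CarnotGroup

variable {n : ℕ} (G : CarnotGroup n)

/-- The distribution `𝓛 f` on `Ω` is the locally integrable function `g`. (The fields `X_k` are
divergence free, so that `𝓛` is its own formal transpose for the Lebesgue measure.) -/
structure HasWeakSubLaplacian (Ω : Set (Fin n → ℝ)) (f g : (Fin n → ℝ) → ℝ) : Prop where
  locallyIntegrableOn : LocallyIntegrableOn g Ω volume
  integral_eq : ∀ φ : (Fin n → ℝ) → ℝ, IsTestFunction Ω φ →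
    ∫ x in Ω, f x * G.subLaplacian φ x = ∫ x in Ω, g x * φ x

/-- `𝓛 f ≤ 0` on `Ω` in the sense of distributions. -/
def WeakSubLaplacianNonpos (Ω : Set (Fin n → ℝ)) (f : (Fin n → ℝ) → ℝ) : Prop :=
  ∀ φ : (Fin n → ℝ) → ℝ, IsTestFunction Ω φ → (∀ x, 0 ≤ φ x) →
    ∫ x in Ω, f x * G.subLaplacian φ x ≤ 0

end CarnotGroup

end

/-! Let `∇` be the horizontal gradient and suppose first that `V` and `|u| ^ p` are smooth.
Superharmonicity of `V ^ σ` then says `(σ - 1) |∇V|² ≤ -V 𝓛V` (`gradient_sq_le_of_rpow`). Put `A = ∫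
V 𝓛(|u| ^ p) = ∫ 𝓛V |u| ^ p` and `D = ∫ V |u| ^ (p - 4) |Re (ū ∇u)|²`. The chain rule and
Cauchy–Schwarz give `-A ≤ -p (p - 1) D + p ∫ V |u| ^ (p - 1) |𝓛u|` (`neg_subLaplacian_regPow_le`).
The arithmetic-geometric mean inequality applied to `2 ∫ ∇V · ∇|u| ^ p = -2A`, with the gradient
bound, gives `-2A ≤ -A + p² / (σ - 1) D` (`sum_X_mul_X_regPow_le`). A multiple of the second
estimate cancels `D` in the first and leaves `((p - 1) σ + 1) / p * (-A) ≤ p ∫ V |u| ^ (p - 1)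
|𝓛u|`. Hölder's inequality bounds the right side by a power of `-A = ∫ |𝓛V| |u| ^ p`, which is
finite and can be divided out.

Two regularizations make this rigorous. The power `|u| ^ p` becomes `(|u|² + δ²) ^ (p / 2) - δ ^ p`,
which is smooth and still supported in the support of `u`; the error is at most a multiple of `δ ^ p
∫ (-𝓛V) χ` for a fixed cutoff `χ`. The weight `V` becomes the `1 / σ`-th power of an average of left
translates of `V ^ σ`: left-invariant fields commute with left translations, so superharmonicity
survives (`exists_smooth_approx`). In the smooth inequality all derivatives can be moved onto test
functions, so locally bounded pointwise convergence of the weights suffices for the limit.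

The integrations by parts rest on the invariance of Lebesgue measure under right translations, which
follows from the dilations (`det_fderiv_eq_of_dilation`). -/

open Filter Topology

/-! ### Smoothness of parameter integrals. -/

/-- Differentiation under an integral over a compact set. -/
theorem hasFDerivAt_setIntegral_smul_of_contDiff {P E Q : Type*} [NormedAddCommGroup P]
    [NormedSpace ℝ P] [FiniteDimensional ℝ P] [NormedAddCommGroup E] [NormedSpace ℝ E]
    [MeasurableSpace E] [BorelSpace E] [SecondCountableTopology E] [NormedAddCommGroup Q]
    [NormedSpace ℝ Q] {μ : Measure E} {K : Set E} (hK : IsCompact K)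
    {w : E → ℝ} (hw : IntegrableOn w K μ) {F : P → E → Q}
    (hF : ContDiff ℝ ∞ (fun q : P × E => F q.1 q.2)) (x : P) :
    HasFDerivAt (fun x => ∫ z in K, w z • F x z ∂μ)
      (∫ z in K, w z • fderiv ℝ (fun y => F y z) x ∂μ) x := by
  have hF' : Continuous (fun q : P × E => fderiv ℝ (fun y => F y q.2) q.1) := by
    have : ContDiff ℝ ∞ (fun q : P × E => fderiv ℝ (fun y => F y q.2) q.1) :=
      ContDiff.fderiv (n := ∞) (f := fun (q : P × E) (y : P) => F y q.2)
        (hF.comp (contDiff_snd.prodMk (contDiff_snd.comp contDiff_fst)))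
        contDiff_fst (by simp)
    exact this.continuous
  obtain ⟨C, hC⟩ := ((isCompact_closedBall x 1).prod hK).exists_bound_of_continuousOn
    hF'.continuousOn
  have hFx : ∀ y, Continuous (F y) := fun y => hF.continuous.comp (Continuous.prodMk_right y)
  have hmeas : ∀ y, AEStronglyMeasurable (fun z => w z • F y z) (μ.restrict K) := fun y =>
    hw.aestronglyMeasurable.smul (hFx y).aestronglyMeasurable
  refine hasFDerivAt_integral_of_dominated_of_fderiv_le (s := Metric.closedBall x 1)
    (F' := fun x z => w z • fderiv ℝ (fun y => F y z) x)
    (bound := fun z => ‖w z‖ * C) (Metric.closedBall_mem_nhds x one_pos)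
    (Eventually.of_forall hmeas) ?_ ?_ ?_ (hw.norm.mul_const C) ?_
  · obtain ⟨D, hD⟩ := hK.exists_bound_of_continuousOn (hFx x).continuousOn
    refine (hw.norm.mul_const D).mono' (hmeas x) ?_
    filter_upwards [ae_restrict_mem hK.measurableSet] with z hz
    rw [norm_smul]
    gcongr
    exact hD z hz
  · exact hw.aestronglyMeasurable.smul
      (hF'.comp (by fun_prop : Continuous fun z : E => (x, z))).aestronglyMeasurable
  · filter_upwards [ae_restrict_mem hK.measurableSet] with z hz y hy
    rw [norm_smul]
    gcongr
    exact hC (y, z) ⟨hy, hz⟩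
  · refine Eventually.of_forall fun z y _ => ?_
    have h : ContDiff ℝ ∞ (fun y => F y z) := hF.comp (contDiff_id.prodMk contDiff_const)
    exact ((h.differentiable (by simp)) y).hasFDerivAt.const_smul _

/-- The derivative is an integral of the same kind with values in `P →L[ℝ] Q`, so induction on `m`
applies once `Q` is generalized; a single universe keeps that new target admissible. -/
theorem contDiff_setIntegral_smul {P E : Type} [NormedAddCommGroup P]
    [NormedSpace ℝ P] [FiniteDimensional ℝ P] [NormedAddCommGroup E] [NormedSpace ℝ E]
    [MeasurableSpace E] [BorelSpace E] [SecondCountableTopology E] {μ : Measure E} {K : Set E}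
    (hK : IsCompact K) {w : E → ℝ} (hw : IntegrableOn w K μ) (m : ℕ) {Q : Type}
    [NormedAddCommGroup Q] [NormedSpace ℝ Q] {F : P → E → Q}
    (hF : ContDiff ℝ ∞ (fun q : P × E => F q.1 q.2)) :
    ContDiff ℝ m (fun x => ∫ z in K, w z • F x z ∂μ) := by
  induction m generalizing Q with
  | zero =>
    exact contDiff_zero.2 (continuous_iff_continuousAt.2 fun x =>
      (hasFDerivAt_setIntegral_smul_of_contDiff hK hw hF x).continuousAt)
  | succ m ih =>
    have hd := hasFDerivAt_setIntegral_smul_of_contDiff hK hw hF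
    rw [Nat.cast_succ, contDiff_succ_iff_fderiv]
    refine ⟨fun x => (hd x).differentiableAt, by simp, ?_⟩
    rw [funext fun x => (hd x).fderiv]
    refine ih ?_
    exact ContDiff.fderiv (n := ∞) (f := fun (q : P × E) (y : P) => F y q.2)
      (hF.comp (contDiff_snd.prodMk (contDiff_snd.comp contDiff_fst))) contDiff_fst (by simp)

/-! ### Calculus of the left-invariant fields. -/

namespace CarnotGroup

variable {n : ℕ} (G : CarnotGroup n)

theorem contDiff_jacobianField (i : Fin n) : ContDiff ℝ ∞ (jacobianField G.mul i) := by
  refine ContDiff.clm_apply ?_ contDiff_const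
  exact ContDiff.fderiv (n := ∞) (f := fun (x y : Fin n → ℝ) => G.mul x y) (g := fun _ => 0)
    G.contDiff_mul contDiff_const (by simp)

section Calculus

variable {F : Type*} [NormedAddCommGroup F] [NormedSpace ℝ F]

theorem contDiff_X {f : (Fin n → ℝ) → F} (hf : ContDiff ℝ ∞ f) (i : Fin n) :
    ContDiff ℝ ∞ (G.X i f) :=
  (hf.fderiv_right (by simp)).clm_apply (G.contDiff_jacobianField i)

theorem contDiff_subLaplacian {f : (Fin n → ℝ) → F} (hf : ContDiff ℝ ∞ f) :
    ContDiff ℝ ∞ (G.subLaplacian f) :=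
  ContDiff.sum fun i _ => G.contDiff_X (G.contDiff_X hf i) i

theorem support_X_subset (f : (Fin n → ℝ) → F) (i : Fin n) :
    Function.support (G.X i f) ⊆ tsupport f := by
  intro x hx
  refine support_fderiv_subset ℝ fun h => hx ?_
  simp [X, h]

theorem tsupport_X_subset (f : (Fin n → ℝ) → F) (i : Fin n) : tsupport (G.X i f) ⊆ tsupport f :=
  closure_minimal (G.support_X_subset f i) (isClosed_tsupport f)

theorem support_subLaplacian_subset (f : (Fin n → ℝ) → F) :
    Function.support (G.subLaplacian f) ⊆ tsupport f := by
  intro x hx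
  by_contra h
  refine hx (Finset.sum_eq_zero fun i _ => ?_)
  by_contra h'
  exact h (G.tsupport_X_subset f i (G.support_X_subset _ i h'))

theorem subLaplacian_eq_zero {f : (Fin n → ℝ) → F} {x : Fin n → ℝ} (hx : x ∉ tsupport f) :
    G.subLaplacian f x = 0 := by
  by_contra h
  exact hx (G.support_subLaplacian_subset f h)

theorem X_eq_zero {f : (Fin n → ℝ) → F} {x : Fin n → ℝ} (hx : x ∉ tsupport f) (i : Fin n) :
    G.X i f x = 0 := by
  by_contra h
  exact hx (G.support_X_subset f i h)

theorem X_mul {f g : (Fin n → ℝ) → ℝ} {x : Fin n → ℝ} (hf : DifferentiableAt ℝ f x)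
    (hg : DifferentiableAt ℝ g x) (i : Fin n) :
    G.X i (fun y => f y * g y) x = f x * G.X i g x + g x * G.X i f x := by
  simp [X, fderiv_fun_mul hf hg]

theorem X_rpow {f : (Fin n → ℝ) → ℝ} {x : Fin n → ℝ} (hf : DifferentiableAt ℝ f x)
    (hx : 0 < f x) (a : ℝ) (i : Fin n) :
    G.X i (fun y => f y ^ a) x = a * f x ^ (a - 1) * G.X i f x := by
  simp [X, (hf.hasFDerivAt.rpow_const (p := a) (Or.inl hx.ne')).fderiv]

theorem X_inner {f g : (Fin n → ℝ) → ℂ} {x : Fin n → ℝ} (hf : DifferentiableAt ℝ f x)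
    (hg : DifferentiableAt ℝ g x) (i : Fin n) :
    G.X i (fun y => inner ℝ (f y) (g y)) x
      = inner ℝ (f x) (G.X i g x) + inner ℝ (G.X i f x) (g x) := by
  simp only [X]
  rw [fderiv_inner_apply ℝ hf hg]

theorem X_const_mul {f : (Fin n → ℝ) → ℝ} {x : Fin n → ℝ} (hf : DifferentiableAt ℝ f x)
    (c : ℝ) (i : Fin n) : G.X i (fun y => c * f y) x = c * G.X i f x := by
  simp [X, fderiv_const_mul hf]

theorem X_add_const (f : (Fin n → ℝ) → ℝ) (c : ℝ) (i : Fin n) :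
    G.X i (fun y => f y + c) = G.X i f := by
  ext x
  simp [X]

theorem subLaplacian_add_const (f : (Fin n → ℝ) → ℝ) (c : ℝ) :
    G.subLaplacian (fun y => f y + c) = G.subLaplacian f := by
  ext x
  simp [subLaplacian, X_add_const]

end Calculus

/-! ### Dilations and the invariance of Lebesgue measure. -/

section Dilations

/-- The dilation as a linear map. -/
noncomputable def dilationLM (t : ℝ) : (Fin n → ℝ) →L[ℝ] (Fin n → ℝ) :=
  ContinuousLinearMap.pi fun i => t ^ G.deg i • ContinuousLinearMap.proj i

theorem dilationLM_apply (t : ℝ) (x : Fin n → ℝ) : G.dilationLM t x = dilation G.deg t x := by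
  ext i
  simp [dilationLM, dilation]

theorem det_dilationLM_ne_zero {t : ℝ} (ht : 0 < t) : (G.dilationLM t).det ≠ 0 := by
  have h : IsUnit ((G.dilationLM t : (Fin n → ℝ) →L[ℝ] (Fin n → ℝ)) :
      (Fin n → ℝ) →ₗ[ℝ] (Fin n → ℝ)) := by
    rw [LinearMap.isUnit_iff_ker_eq_bot, LinearMap.ker_eq_bot']
    intro x hx
    ext i
    have := congrFun hx i
    simpa [dilationLM, ht.ne'] using this
  exact (LinearMap.isUnit_iff_isUnit_det _).1 h |>.ne_zero

theorem tendsto_dilation (x : Fin n → ℝ) :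
    Tendsto (fun t => dilation G.deg t x) (𝓝[>] 0) (𝓝 0) := by
  rw [tendsto_pi_nhds]
  intro i
  have h : Continuous fun t : ℝ => t ^ G.deg i * x i := by fun_prop
  have := (h.tendsto 0).mono_left (nhdsWithin_le_nhds (s := Set.Ioi 0))
  simpa [dilation, (Nat.one_le_iff_ne_zero.1 (G.deg_pos i))] using this

theorem inv_dilation {t : ℝ} (ht : 0 < t) (x : Fin n → ℝ) :
    G.inv (dilation G.deg t x) = dilation G.deg t (G.inv x) := by
  have h : G.mul (dilation G.deg t (G.inv x)) (dilation G.deg t x) = 0 := by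
    rw [← G.dilation_mul t ht, G.inv_mul]
    ext i
    simp [dilation]
  calc G.inv (dilation G.deg t x)
      = G.mul (G.mul (dilation G.deg t (G.inv x)) (dilation G.deg t x))
          (G.inv (dilation G.deg t x)) := by rw [h, G.zero_mul]
    _ = _ := by rw [G.mul_assoc, G.mul_inv, G.mul_zero]

/-- The Jacobian of a smooth map `Φ a` is constant if `Φ` commutes with the dilations. -/
theorem det_fderiv_eq_of_dilation {Φ : (Fin n → ℝ) → (Fin n → ℝ) → (Fin n → ℝ)}
    (hΦ : ContDiff ℝ ∞ (fun q : (Fin n → ℝ) × (Fin n → ℝ) => Φ q.1 q.2))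
    (hdil : ∀ t : ℝ, 0 < t → ∀ a z,
      Φ (dilation G.deg t a) (dilation G.deg t z) = dilation G.deg t (Φ a z))
    (a z : Fin n → ℝ) : (fderiv ℝ (Φ a) z).det = (fderiv ℝ (Φ 0) 0).det := by
  have hd : ∀ a, Differentiable ℝ (Φ a) := fun a =>
    (hΦ.comp (contDiff_const.prodMk contDiff_id) : ContDiff ℝ ∞ (Φ a)).differentiable (by simp)
  have hcont : Continuous fun q : (Fin n → ℝ) × (Fin n → ℝ) => (fderiv ℝ (Φ q.1) q.2).det := by
    refine ContinuousLinearMap.continuous_det.comp ?_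
    have : ContDiff ℝ ∞ fun q : (Fin n → ℝ) × (Fin n → ℝ) => fderiv ℝ (Φ q.1) q.2 :=
      ContDiff.fderiv (n := ∞) (f := fun (q : (Fin n → ℝ) × (Fin n → ℝ)) (y : Fin n → ℝ) => Φ q.1 y)
        (hΦ.comp ((contDiff_fst.comp contDiff_fst).prodMk contDiff_snd)) contDiff_snd (by simp)
    exact this.continuous
  -- Differentiating the equivariance relation gives `DΦ ∘ δ_t = δ_t ∘ DΦ` at corresponding points;
  -- the determinant of `δ_t` cancels.
  have hscale : ∀ t : ℝ, 0 < t →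
      (fderiv ℝ (Φ (dilation G.deg t a)) (dilation G.deg t z)).det = (fderiv ℝ (Φ a) z).det := by
    intro t ht
    have h1 : HasFDerivAt (fun y => Φ (dilation G.deg t a) (G.dilationLM t y))
        ((fderiv ℝ (Φ (dilation G.deg t a)) (dilation G.deg t z)).comp (G.dilationLM t)) z := by
      refine HasFDerivAt.comp z ?_ (G.dilationLM t).hasFDerivAt
      rw [dilationLM_apply]
      exact (hd _ _).hasFDerivAt
    have h2 : HasFDerivAt (fun y => G.dilationLM t (Φ a y))
        ((G.dilationLM t).comp (fderiv ℝ (Φ a) z)) z :=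
      (G.dilationLM t).hasFDerivAt.comp z (hd a z).hasFDerivAt
    have h3 : (fun y => Φ (dilation G.deg t a) (G.dilationLM t y))
        = fun y => G.dilationLM t (Φ a y) := by
      ext1 y
      rw [dilationLM_apply, dilationLM_apply, hdil t ht]
    rw [h3] at h1
    have h4 := congrArg ContinuousLinearMap.det (h1.unique h2)
    have hcomp : ∀ A B : (Fin n → ℝ) →L[ℝ] (Fin n → ℝ), (A.comp B).det = A.det * B.det :=
      fun A B => LinearMap.det_comp (A : (Fin n → ℝ) →ₗ[ℝ] (Fin n → ℝ)) B
    rw [hcomp, hcomp, mul_comm] at h4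
    exact mul_left_cancel₀ (G.det_dilationLM_ne_zero ht) h4
  -- All degrees are positive, so `δ_t` contracts every point to `0` as `t → 0`.
  have hlim : Tendsto (fun t => (fderiv ℝ (Φ (dilation G.deg t a)) (dilation G.deg t z)).det)
      (𝓝[>] 0) (𝓝 (fderiv ℝ (Φ 0) 0).det) :=
    (hcont.tendsto (0, 0)).comp ((G.tendsto_dilation a).prodMk_nhds (G.tendsto_dilation z))
  refine tendsto_nhds_unique (tendsto_const_nhds.congr' ?_) hlim
  filter_upwards [self_mem_nhdsWithin] with t ht
  exact (hscale t ht).symm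

theorem integral_comp_eq_of_dilation {Φ : (Fin n → ℝ) → (Fin n → ℝ) → (Fin n → ℝ)}
    (hΦ : ContDiff ℝ ∞ (fun q : (Fin n → ℝ) × (Fin n → ℝ) => Φ q.1 q.2))
    (hdil : ∀ t : ℝ, 0 < t → ∀ a z,
      Φ (dilation G.deg t a) (dilation G.deg t z) = dilation G.deg t (Φ a z))
    (hdet : |(fderiv ℝ (Φ 0) 0).det| = 1) (a : Fin n → ℝ) (hbij : Function.Bijective (Φ a))
    (h : (Fin n → ℝ) → ℝ) : ∫ z, h (Φ a z) = ∫ z, h z := by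
  have hd : Differentiable ℝ (Φ a) :=
    (hΦ.comp (contDiff_const.prodMk contDiff_id) : ContDiff ℝ ∞ (Φ a)).differentiable (by simp)
  have := integral_image_eq_integral_abs_det_fderiv_smul volume MeasurableSet.univ
    (fun x _ => (hd x).hasFDerivAt.hasFDerivWithinAt) hbij.injective.injOn h
  simp only [G.det_fderiv_eq_of_dilation hΦ hdil, hdet, one_smul, Set.image_univ,
    hbij.surjective.range_eq, setIntegral_univ] at this
  exact this.symm

/-- Right translations are the relevant ones: the left-invariant fields are their infinitesimal
generators. At `a = 0` the map is the identity, so the constant Jacobian is `1`. -/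
theorem integral_comp_mul_right (a : Fin n → ℝ) (h : (Fin n → ℝ) → ℝ) :
    ∫ z, h (G.mul z a) = ∫ z, h z := by
  refine G.integral_comp_eq_of_dilation (Φ := fun a z => G.mul z a)
    (G.contDiff_mul.comp (contDiff_snd.prodMk contDiff_fst))
    (fun t ht a z => (G.dilation_mul t ht z a).symm) ?_ a ?_ h
  · simp only [G.mul_zero]
    rw [fderiv_fun_id]
    simp [ContinuousLinearMap.det]
  · refine Function.bijective_iff_has_inverse.2 ⟨fun z => G.mul z (G.inv a), fun z => ?_, fun z => ?_⟩
    · simp [G.mul_assoc, G.mul_inv, G.mul_zero]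
    · simp [G.mul_assoc, G.inv_mul, G.mul_zero]

theorem inv_zero : G.inv 0 = 0 := by
  rw [← G.zero_mul (G.inv 0), G.mul_inv]

theorem inv_inv (x : Fin n → ℝ) : G.inv (G.inv x) = x := by
  rw [← G.mul_zero (G.inv (G.inv x)), ← G.inv_mul x, ← G.mul_assoc, G.inv_mul, G.zero_mul]

theorem inv_mul_rev (x y : Fin n → ℝ) : G.inv (G.mul x y) = G.mul (G.inv y) (G.inv x) := by
  have h : G.mul (G.mul (G.inv y) (G.inv x)) (G.mul x y) = 0 := by
    rw [G.mul_assoc, ← G.mul_assoc _ x y, G.inv_mul, G.zero_mul, G.inv_mul]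
  rw [← G.zero_mul (G.inv (G.mul x y)), ← h, G.mul_assoc, G.mul_inv, G.mul_zero]

/-- The group law restricts to the identity on each of the two factors, and the derivative is
additive. -/
theorem fderiv_mul_zero (x y : Fin n → ℝ) :
    fderiv ℝ (fun z : (Fin n → ℝ) × (Fin n → ℝ) => G.mul z.1 z.2) (0, 0) (x, y) = x + y := by
  have hd : HasFDerivAt (fun z : (Fin n → ℝ) × (Fin n → ℝ) => G.mul z.1 z.2) _ (0, 0) :=
    (G.contDiff_mul.differentiable (by simp) (0, 0)).hasFDerivAt
  have h1 := hd.comp (f := fun y : Fin n → ℝ => (y, (0 : Fin n → ℝ))) 0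
    (hasFDerivAt_prodMk_left 0 0)
  have h2 := hd.comp (f := fun y : Fin n → ℝ => ((0 : Fin n → ℝ), y)) 0
    (hasFDerivAt_prodMk_right 0 0)
  simp only [Function.comp_def, G.mul_zero] at h1
  simp only [Function.comp_def, G.zero_mul] at h2
  have e1 := congrArg (fun A : (Fin n → ℝ) →L[ℝ] (Fin n → ℝ) => A x) (h1.unique (hasFDerivAt_id 0))
  have e2 := congrArg (fun A : (Fin n → ℝ) →L[ℝ] (Fin n → ℝ) => A y) (h2.unique (hasFDerivAt_id 0))
  simp only [ContinuousLinearMap.comp_apply, ContinuousLinearMap.inl_apply,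
    ContinuousLinearMap.inr_apply, ContinuousLinearMap.id_apply] at e1 e2
  rw [← Prod.fst_add_snd (x, y), map_add]
  exact congrArg₂ (· + ·) e1 e2

theorem hasFDerivAt_inv_zero :
    HasFDerivAt G.inv (-ContinuousLinearMap.id ℝ (Fin n → ℝ)) 0 := by
  have hi : HasFDerivAt G.inv _ 0 := (G.contDiff_inv.differentiable (by simp) 0).hasFDerivAt
  have hd : HasFDerivAt (fun z : (Fin n → ℝ) × (Fin n → ℝ) => G.mul z.1 z.2) _
      (G.inv 0, (0 : Fin n → ℝ)) :=
    (G.contDiff_mul.differentiable (by simp) _).hasFDerivAt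
  have h := hd.comp (f := fun x => (G.inv x, id x)) (0 : Fin n → ℝ) (hi.prodMk (hasFDerivAt_id 0))
  have hc : ((fun z : (Fin n → ℝ) × (Fin n → ℝ) => G.mul z.1 z.2) ∘ fun x => (G.inv x, id x))
      = fun _ => 0 := by
    ext1 x
    exact G.inv_mul x
  rw [hc, G.inv_zero] at h
  have e := h.unique (hasFDerivAt_const 0 0)
  suffices hs : fderiv ℝ G.inv 0 = -ContinuousLinearMap.id ℝ (Fin n → ℝ) by rwa [hs] at hi
  ext1 y
  have ey := congrArg (fun A : (Fin n → ℝ) →L[ℝ] (Fin n → ℝ) => A y) e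
  simp only [ContinuousLinearMap.comp_apply, ContinuousLinearMap.prod_apply,
    G.fderiv_mul_zero] at ey
  exact eq_neg_of_add_eq_zero_left ey

/-- Inversion has derivative `-1` at `0`, so the constant Jacobian is `(-1) ^ n`. This normalizes
the kernels `z ↦ ψ (x ∘ z⁻¹)`. -/
theorem integral_comp_mul_inv (a : Fin n → ℝ) (h : (Fin n → ℝ) → ℝ) :
    ∫ z, h (G.mul a (G.inv z)) = ∫ z, h z := by
  refine G.integral_comp_eq_of_dilation (Φ := fun a z => G.mul a (G.inv z))
    (G.contDiff_mul.comp (contDiff_fst.prodMk (G.contDiff_inv.comp contDiff_snd)))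
    (fun t ht a z => by rw [G.dilation_mul t ht, G.inv_dilation ht]) ?_ a ?_ h
  · simp only [G.zero_mul]
    rw [G.hasFDerivAt_inv_zero.fderiv]
    have h1 : (((-ContinuousLinearMap.id ℝ (Fin n → ℝ)) : (Fin n → ℝ) →L[ℝ] (Fin n → ℝ)) :
        (Fin n → ℝ) →ₗ[ℝ] (Fin n → ℝ)) = (-1 : ℝ) • LinearMap.id := by
      ext; simp
    rw [ContinuousLinearMap.det, h1, LinearMap.det_smul]
    simp [abs_pow]
  · refine Function.bijective_iff_has_inverse.2 ⟨fun z => G.mul (G.inv z) a, fun z => ?_, fun z => ?_⟩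
    · simp [G.inv_mul_rev, G.mul_assoc, G.inv_mul, G.mul_zero, G.inv_inv]
    · simp only [G.inv_mul_rev, G.inv_inv]
      rw [← G.mul_assoc, G.mul_inv, G.zero_mul]

end Dilations

end CarnotGroup

/-! ### Integration by parts. -/

namespace CarnotGroup

variable {n : ℕ} (G : CarnotGroup n)

theorem contDiff_mul_comp {E : Type*} [NormedAddCommGroup E] [NormedSpace ℝ E]
    {f g : E → Fin n → ℝ} (hf : ContDiff ℝ ∞ f) (hg : ContDiff ℝ ∞ g) :
    ContDiff ℝ ∞ fun x => G.mul (f x) (g x) :=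
  G.contDiff_mul.comp (hf.prodMk hg)

theorem hasFDerivAt_mul_left_zero (z : Fin n → ℝ) :
    HasFDerivAt (fun y => G.mul z y) (fderiv ℝ (fun y => G.mul z y) 0) 0 :=
  ((G.contDiff_mul_comp contDiff_const contDiff_id).differentiable (by simp) 0).hasFDerivAt

/-- The derivative along `X_k` is the derivative along the curve `t ↦ z ∘ γ(t)` if `γ` passes
through `0` with velocity `∂ / ∂x_k`. -/
theorem fderiv_comp_mul_left_zero {F : Type*} [NormedAddCommGroup F] [NormedSpace ℝ F]
    {h : (Fin n → ℝ) → F} {z : Fin n → ℝ} (hh : DifferentiableAt ℝ h z) (i : Fin n) :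
    fderiv ℝ (fun y => h (G.mul z y)) 0 (Pi.single i 1) = G.X i h z := by
  have h1 : HasFDerivAt h (fderiv ℝ h z) (G.mul z 0) := by
    rw [G.mul_zero]
    exact hh.hasFDerivAt
  have h2 := (h1.comp (f := fun y => G.mul z y) 0 (G.hasFDerivAt_mul_left_zero z)).fderiv
  rw [Function.comp_def] at h2
  rw [h2]
  rfl

/-- The Jacobian generators are divergence free. -/
theorem integral_X_eq_zero {h : (Fin n → ℝ) → ℝ} (hh : ContDiff ℝ ∞ h)
    (hc : HasCompactSupport h) (i : Fin n) : ∫ z, G.X i h z = 0 := by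
  set B : Set (Fin n → ℝ) := Metric.closedBall 0 1
  have hmulc : Continuous fun z : (Fin n → ℝ) × (Fin n → ℝ) => G.mul z.1 z.2 :=
    G.contDiff_mul.continuous
  -- One compact set outside which `z ↦ h (z ∘ a)` vanishes, for every `a` in the unit ball.
  set K : Set (Fin n → ℝ) :=
    (fun q : (Fin n → ℝ) × (Fin n → ℝ) => G.mul q.1 (G.inv q.2)) '' (tsupport h ×ˢ B) with hKdef
  have hK : IsCompact K := by
    refine (hc.isCompact.prod (isCompact_closedBall 0 1)).image ?_
    exact hmulc.comp (continuous_fst.prodMk (G.contDiff_inv.continuous.comp continuous_snd))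
  have hzero : ∀ a ∈ B, ∀ z ∉ K, h (G.mul z a) = 0 := by
    intro a ha z hz
    by_contra hne
    refine hz ⟨(G.mul z a, a), ⟨subset_tsupport h hne, ha⟩, ?_⟩
    simp [G.mul_assoc, G.mul_inv, G.mul_zero]
  have hF : ContDiff ℝ ∞ fun q : (Fin n → ℝ) × (Fin n → ℝ) => h (G.mul q.2 q.1) :=
    hh.comp (G.contDiff_mul_comp contDiff_snd contDiff_fst)
  have hw : IntegrableOn (fun _ : Fin n → ℝ => (1 : ℝ)) K := by
    exact integrableOn_const (C := (1 : ℝ)) (hK.measure_lt_top.ne)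
  have hd := hasFDerivAt_setIntegral_smul_of_contDiff hK hw (F := fun a z => h (G.mul z a)) hF 0
  -- By right invariance the integral does not depend on small `a`; its derivative at `a = 0` in the
  -- direction `e_i`, which is the integral of `X_i h`, therefore vanishes.
  have hev : (fun a => ∫ z in K, (1 : ℝ) • h (G.mul z a)) =ᶠ[𝓝 0] fun _ => ∫ z, h z := by
    filter_upwards [Metric.closedBall_mem_nhds (0 : Fin n → ℝ) one_pos] with a ha
    simp only [one_smul]
    rw [setIntegral_eq_integral_of_forall_compl_eq_zero (hzero a ha), G.integral_comp_mul_right]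
  have h0 := (hd.congr_of_eventuallyEq hev.symm).unique (hasFDerivAt_const (∫ z, h z) 0)
  have hdiff := hh.differentiable (by simp)
  have hcont : Continuous fun z => fderiv ℝ (fun a => h (G.mul z a)) 0 := by
    have : ContDiff ℝ ∞ fun z : Fin n → ℝ => fderiv ℝ (fun a => h (G.mul z a)) 0 :=
      ContDiff.fderiv (n := ∞) (f := fun z a : Fin n → ℝ => h (G.mul z a)) (g := fun _ => 0)
        (hh.comp G.contDiff_mul) contDiff_const (by simp)
    exact this.continuous
  have h1 := congrArg (fun A : (Fin n → ℝ) →L[ℝ] ℝ => A (Pi.single i 1)) h0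
  simp only [one_smul] at h1
  rw [ContinuousLinearMap.integral_apply (hcont.continuousOn.integrableOn_compact hK)] at h1
  simp only [G.fderiv_comp_mul_left_zero (hdiff _), _root_.zero_apply] at h1
  rwa [setIntegral_eq_integral_of_forall_compl_eq_zero] at h1
  intro z hz
  refine G.X_eq_zero (fun hzs => hz ⟨(z, 0), ⟨hzs, by simp [B]⟩, ?_⟩) i
  simp [G.inv_zero, G.mul_zero]

theorem integral_mul_X_X {v g : (Fin n → ℝ) → ℝ} (hv : ContDiff ℝ ∞ v) (hg : ContDiff ℝ ∞ g)
    (hc : HasCompactSupport g) (i : Fin n) :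
    ∫ z, v z * G.X i (G.X i g) z = -∫ z, G.X i v z * G.X i g z := by
  have hXg := G.contDiff_X hg i
  have hXv := G.contDiff_X hv i
  have hcX : HasCompactSupport (G.X i g) := hc.mono' (G.support_X_subset g i)
  have hcXX : HasCompactSupport (G.X i (G.X i g)) := hcX.mono' (G.support_X_subset _ i)
  have h := G.integral_X_eq_zero (hv.mul hXg) hcX.mul_left i
  have e : ∀ z, G.X i (fun x => v x * G.X i g x) z
      = v z * G.X i (G.X i g) z + G.X i g z * G.X i v z := fun z =>
    G.X_mul (hv.differentiable (by simp) z) (hXg.differentiable (by simp) z) i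
  rw [integral_congr_ae (Eventually.of_forall e), integral_add] at h
  · rw [eq_neg_of_add_eq_zero_left h]
    simp only [mul_comm]
  · exact (hv.continuous.mul (G.contDiff_X hXg i).continuous).integrable_of_hasCompactSupport
      hcXX.mul_left
  · exact (hXg.continuous.mul hXv.continuous).integrable_of_hasCompactSupport hcX.mul_right

theorem integral_X_X_mul {v g : (Fin n → ℝ) → ℝ} (hv : ContDiff ℝ ∞ v) (hg : ContDiff ℝ ∞ g)
    (hc : HasCompactSupport g) (i : Fin n) :
    ∫ z, G.X i (G.X i v) z * g z = -∫ z, G.X i v z * G.X i g z := by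
  have hXg := G.contDiff_X hg i
  have hXv := G.contDiff_X hv i
  have hcX : HasCompactSupport (G.X i g) := hc.mono' (G.support_X_subset g i)
  have h := G.integral_X_eq_zero (hXv.mul hg) hc.mul_left i
  have e : ∀ z, G.X i (fun x => G.X i v x * g x) z
      = G.X i v z * G.X i g z + g z * G.X i (G.X i v) z := fun z =>
    G.X_mul (hXv.differentiable (by simp) z) (hg.differentiable (by simp) z) i
  rw [integral_congr_ae (Eventually.of_forall e), integral_add] at h
  · rw [← eq_neg_of_add_eq_zero_right h]
    simp only [mul_comm]
  · exact (hXv.continuous.mul hXg.continuous).integrable_of_hasCompactSupport hcX.mul_left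
  · exact (hg.continuous.mul (G.contDiff_X hXv i).continuous).integrable_of_hasCompactSupport
      hc.mul_right

/-! ### Convolution kernels `φ (x ∘ z⁻¹)`. -/

section TranslatedKernel

variable {φ : (Fin n → ℝ) → ℝ}

theorem contDiff_kernel (hφ : ContDiff ℝ ∞ φ) :
    ContDiff ℝ ∞ fun q : (Fin n → ℝ) × (Fin n → ℝ) => φ (G.mul q.1 (G.inv q.2)) :=
  hφ.comp (G.contDiff_mul_comp contDiff_fst (G.contDiff_inv.comp contDiff_snd))

/-- Since `x ∘ (z ∘ y)⁻¹ = (x ∘ y⁻¹) ∘ z⁻¹`, moving `z` along `y` amounts to moving `x` along `y⁻¹`,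
and inversion has derivative `-1` at `0`. -/
theorem X_kernel (hφ : ContDiff ℝ ∞ φ) (x z : Fin n → ℝ) (i : Fin n) :
    G.X i (fun z => φ (G.mul x (G.inv z))) z = -G.X i (fun x => φ (G.mul x (G.inv z))) x := by
  have hm : ContDiff ℝ ∞ fun a => φ (G.mul (G.mul x a) (G.inv z)) :=
    hφ.comp (G.contDiff_mul_comp (G.contDiff_mul_comp contDiff_const contDiff_id) contDiff_const)
  have hx : ContDiff ℝ ∞ fun x => φ (G.mul x (G.inv z)) :=
    hφ.comp (G.contDiff_mul_comp contDiff_id contDiff_const)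
  have hz : ContDiff ℝ ∞ fun z => φ (G.mul x (G.inv z)) :=
    hφ.comp (G.contDiff_mul_comp contDiff_const G.contDiff_inv)
  rw [← G.fderiv_comp_mul_left_zero (hx.differentiable (by simp) x),
    ← G.fderiv_comp_mul_left_zero (hz.differentiable (by simp) z)]
  have e : (fun y => φ (G.mul x (G.inv (G.mul z y))))
      = (fun a => φ (G.mul (G.mul x a) (G.inv z))) ∘ G.inv := by
    ext y
    simp [G.inv_mul_rev, G.mul_assoc]
  have hd : HasFDerivAt (fun a => φ (G.mul (G.mul x a) (G.inv z)))
      (fderiv ℝ (fun a => φ (G.mul (G.mul x a) (G.inv z))) 0) (G.inv 0) := by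
    rw [G.inv_zero]
    exact (hm.differentiable (by simp) 0).hasFDerivAt
  rw [e, (hd.comp 0 G.hasFDerivAt_inv_zero).fderiv]
  simp

theorem fderiv_prodMk_left_apply {F : (Fin n → ℝ) × (Fin n → ℝ) → ℝ} {x z : Fin n → ℝ}
    (hF : DifferentiableAt ℝ F (x, z)) (a : Fin n → ℝ) :
    fderiv ℝ (fun x => F (x, z)) x a = fderiv ℝ F (x, z) (a, 0) := by
  have h := (hF.hasFDerivAt.comp (f := fun x => (x, z)) x (hasFDerivAt_prodMk_left x z)).fderiv
  rw [Function.comp_def] at h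
  simp [h]

theorem fderiv_prodMk_right_apply {F : (Fin n → ℝ) × (Fin n → ℝ) → ℝ} {x z : Fin n → ℝ}
    (hF : DifferentiableAt ℝ F (x, z)) (a : Fin n → ℝ) :
    fderiv ℝ (fun z => F (x, z)) z a = fderiv ℝ F (x, z) (0, a) := by
  have h := (hF.hasFDerivAt.comp (f := fun z => (x, z)) z (hasFDerivAt_prodMk_right x z)).fderiv
  rw [Function.comp_def] at h
  simp [h]

theorem X_X_comm {F : (Fin n → ℝ) × (Fin n → ℝ) → ℝ} (hF : ContDiff ℝ ∞ F)
    (x z : Fin n → ℝ) (i j : Fin n) :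
    G.X i (fun z => G.X j (fun x => F (x, z)) x) z
      = G.X j (fun x => G.X i (fun z => F (x, z)) z) x := by
  have hd : Differentiable ℝ F := hF.differentiable (by simp)
  have hd2 : Differentiable ℝ (fderiv ℝ F) :=
    (hF.fderiv_right (m := ∞) (by simp)).differentiable (by simp)
  simp only [X, fderiv_prodMk_left_apply (hd _), fderiv_prodMk_right_apply (hd _)]
  set a := jacobianField G.mul i z
  set b := jacobianField G.mul j x
  have h1 : fderiv ℝ (fun z => fderiv ℝ F (x, z) (b, 0)) z a
      = fderiv ℝ (fderiv ℝ F) (x, z) (0, a) (b, 0) := by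
    have h := ((hd2 (x, z)).hasFDerivAt.comp (f := fun z => (x, z)) z
      (hasFDerivAt_prodMk_right x z)).clm_apply (hasFDerivAt_const (b, (0 : Fin n → ℝ)) z)
    simp only [Function.comp_apply] at h
    rw [h.fderiv]
    simp
  have h2 : fderiv ℝ (fun x => fderiv ℝ F (x, z) (0, a)) x b
      = fderiv ℝ (fderiv ℝ F) (x, z) (b, 0) (0, a) := by
    have h := ((hd2 (x, z)).hasFDerivAt.comp (f := fun x => (x, z)) x
      (hasFDerivAt_prodMk_left x z)).clm_apply (hasFDerivAt_const ((0 : Fin n → ℝ), a) x)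
    simp only [Function.comp_apply] at h
    rw [h.fderiv]
    simp
  rw [h1, h2]
  exact (hF.contDiffAt.isSymmSndFDerivAt (by
    rw [minSmoothness_of_isRCLikeNormedField]
    exact WithTop.coe_le_coe.2 (le_top (a := (2 : ℕ∞))))) _ _

theorem contDiff_X_left {F : (Fin n → ℝ) → (Fin n → ℝ) → ℝ}
    (hF : ContDiff ℝ ∞ fun q : (Fin n → ℝ) × (Fin n → ℝ) => F q.1 q.2) (i : Fin n) :
    ContDiff ℝ ∞ fun q : (Fin n → ℝ) × (Fin n → ℝ) => G.X i (fun x => F x q.2) q.1 := by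
  refine ContDiff.clm_apply ?_ ((G.contDiff_jacobianField i).comp contDiff_fst)
  exact ContDiff.fderiv (n := ∞)
    (f := fun (q : (Fin n → ℝ) × (Fin n → ℝ)) (y : Fin n → ℝ) => F y q.2)
    (hF.comp (contDiff_snd.prodMk (contDiff_snd.comp contDiff_fst))) contDiff_fst (by simp)

/-- Trading one derivative between the variables costs a sign on either side, and the two mixed
derivatives agree. The sub-Laplacian of a mollification thereby falls on a test function of `z`. -/
theorem subLaplacian_kernel (hφ : ContDiff ℝ ∞ φ) (x z : Fin n → ℝ) :
    G.subLaplacian (fun x => φ (G.mul x (G.inv z))) x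
      = G.subLaplacian (fun z => φ (G.mul x (G.inv z))) z := by
  refine Finset.sum_congr rfl fun i _ => ?_
  have hk := G.contDiff_kernel hφ
  have e1 : G.X i (fun z => φ (G.mul x (G.inv z)))
      = fun z => -G.X i (fun x => φ (G.mul x (G.inv z))) x :=
    funext fun z => G.X_kernel hφ x z i
  have e2 : G.X i (fun x => φ (G.mul x (G.inv z)))
      = fun x => -G.X i (fun z => φ (G.mul x (G.inv z))) z :=
    funext fun x => by rw [G.X_kernel hφ x z i, neg_neg]
  have hneg : ∀ (f : (Fin n → ℝ) → ℝ) (y : Fin n → ℝ),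
      G.X i (fun y => -f y) y = -G.X i f y := fun f y => by simp [X, fderiv_fun_neg]
  rw [e1, e2, hneg, hneg]
  exact congrArg _ (G.X_X_comm hk x z i i).symm

theorem X_setIntegral {F : (Fin n → ℝ) → (Fin n → ℝ) → ℝ}
    (hF : ContDiff ℝ ∞ fun q : (Fin n → ℝ) × (Fin n → ℝ) => F q.1 q.2)
    {K : Set (Fin n → ℝ)} (hK : IsCompact K) {w : (Fin n → ℝ) → ℝ} (hw : IntegrableOn w K)
    (i : Fin n) :
    G.X i (fun x => ∫ z in K, w z • F x z)
      = fun x => ∫ z in K, w z • G.X i (fun x => F x z) x := by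
  ext x
  have hd := hasFDerivAt_setIntegral_smul_of_contDiff hK hw hF x
  have hcont : Continuous fun z => fderiv ℝ (fun y => F y z) x :=
    (ContDiff.fderiv (n := ∞) (f := fun (z y : Fin n → ℝ) => F y z) (g := fun _ => x) (m := ∞)
      (hF.comp (contDiff_snd.prodMk contDiff_fst)) contDiff_const (by simp)).continuous
  simp only [X, hd.fderiv]
  rw [ContinuousLinearMap.integral_apply (hw.smul_continuousOn hcont.continuousOn hK)]
  rfl

theorem subLaplacian_setIntegral {F : (Fin n → ℝ) → (Fin n → ℝ) → ℝ}
    (hF : ContDiff ℝ ∞ fun q : (Fin n → ℝ) × (Fin n → ℝ) => F q.1 q.2)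
    {K : Set (Fin n → ℝ)} (hK : IsCompact K) {w : (Fin n → ℝ) → ℝ} (hw : IntegrableOn w K)
    (x : Fin n → ℝ) :
    G.subLaplacian (fun x => ∫ z in K, w z • F x z) x
      = ∫ z in K, w z • G.subLaplacian (fun x => F x z) x := by
  simp only [subLaplacian, Finset.smul_sum]
  rw [integral_finsetSum]
  · refine Finset.sum_congr rfl fun i _ => ?_
    rw [G.X_setIntegral hF hK hw, G.X_setIntegral (G.contDiff_X_left hF i) hK hw]
  · intro i _
    have hc := (G.contDiff_X_left (F := fun x z => G.X i (fun x => F x z) x)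
      (G.contDiff_X_left hF i) i).continuous.comp
      (Continuous.prodMk_right x)
    exact hw.smul_continuousOn hc.continuousOn hK

end TranslatedKernel

end CarnotGroup

/-! ### Regularized powers of `|u|`. -/

/-- The regularization `|u|² + δ²` of the square of the modulus. -/
noncomputable def regNormSq {n : ℕ} (u : (Fin n → ℝ) → ℂ) (δ : ℝ) (x : Fin n → ℝ) : ℝ :=
  inner ℝ (u x) (u x) + δ ^ 2

/-- The regularization `(|u|² + δ²) ^ (p / 2) - (δ²) ^ (p / 2)` of the power `|u| ^ p`. -/
noncomputable def regPow {n : ℕ} (u : (Fin n → ℝ) → ℂ) (δ p : ℝ) (x : Fin n → ℝ) : ℝ :=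
  regNormSq u δ x ^ (p / 2) + -(δ ^ 2) ^ (p / 2)

section Regularization

variable {n : ℕ} {u : (Fin n → ℝ) → ℂ} {δ : ℝ}

theorem regNormSq_eq (u : (Fin n → ℝ) → ℂ) (δ : ℝ) (x : Fin n → ℝ) :
    regNormSq u δ x = ‖u x‖ ^ 2 + δ ^ 2 := by
  rw [regNormSq, real_inner_self_eq_norm_sq]

theorem regNormSq_pos (hδ : 0 < δ) (x : Fin n → ℝ) : 0 < regNormSq u δ x := by
  rw [regNormSq_eq]
  positivity

theorem contDiff_regNormSq (hu : ContDiff ℝ ∞ u) (δ : ℝ) : ContDiff ℝ ∞ (regNormSq u δ) :=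
  (hu.inner ℝ hu).add contDiff_const

theorem contDiff_regNormSq_rpow (hu : ContDiff ℝ ∞ u) (hδ : 0 < δ) (a : ℝ) :
    ContDiff ℝ ∞ fun x => regNormSq u δ x ^ a :=
  (contDiff_regNormSq hu δ).rpow_const_of_ne fun x => (regNormSq_pos hδ x).ne'

theorem contDiff_regPow (hu : ContDiff ℝ ∞ u) (hδ : 0 < δ) (p : ℝ) :
    ContDiff ℝ ∞ (regPow u δ p) :=
  (contDiff_regNormSq_rpow hu hδ _).add contDiff_const

theorem regPow_eq_zero {x : Fin n → ℝ} (hx : u x = 0) (p : ℝ) : regPow u δ p x = 0 := by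
  simp [regPow, regNormSq, hx]

theorem tsupport_regPow_subset (p : ℝ) : tsupport (regPow u δ p) ⊆ tsupport u :=
  closure_mono fun _ hx h => hx (regPow_eq_zero h p)

theorem regPow_nonneg {p : ℝ} (hp : 0 ≤ p) (x : Fin n → ℝ) : 0 ≤ regPow u δ p x := by
  rw [regPow, ← sub_eq_add_neg, sub_nonneg]
  refine Real.rpow_le_rpow (by positivity) ?_ (by positivity)
  rw [regNormSq_eq]
  nlinarith [sq_nonneg ‖u x‖]

end Regularization

/-! ### The inequality for smooth weights. -/

namespace CarnotGroup

variable {n : ℕ} (G : CarnotGroup n) {u : (Fin n → ℝ) → ℂ} {δ : ℝ}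

theorem X_regNormSq (hu : ContDiff ℝ ∞ u) (δ : ℝ) (i : Fin n) (x : Fin n → ℝ) :
    G.X i (regNormSq u δ) x = 2 * inner ℝ (u x) (G.X i u x) := by
  have hd := hu.differentiable (by simp) x
  have := congrFun (G.X_add_const (fun x => inner ℝ (u x) (u x)) (δ ^ 2) i) x
  rw [G.X_inner hd hd, real_inner_comm (u x)] at this
  rw [two_mul]
  exact this

theorem X_regPow (hu : ContDiff ℝ ∞ u) (hδ : 0 < δ) (p : ℝ) (i : Fin n) (x : Fin n → ℝ) :
    G.X i (regPow u δ p) x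
      = p * (regNormSq u δ x ^ (p / 2 - 1) * inner ℝ (u x) (G.X i u x)) := by
  have h := congrFun (G.X_add_const (fun x => regNormSq u δ x ^ (p / 2)) (-(δ ^ 2) ^ (p / 2)) i) x
  rw [G.X_rpow ((contDiff_regNormSq hu δ).differentiable (by simp) x) (regNormSq_pos hδ x),
    G.X_regNormSq hu] at h
  refine h.trans ?_
  ring

theorem X_X_regPow (hu : ContDiff ℝ ∞ u) (hδ : 0 < δ) (p : ℝ) (i : Fin n) (x : Fin n → ℝ) :
    G.X i (G.X i (regPow u δ p)) x
      = p * ((p - 2) * (regNormSq u δ x ^ (p / 2 - 2) * inner ℝ (u x) (G.X i u x) ^ 2)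
        + regNormSq u δ x ^ (p / 2 - 1)
          * (‖G.X i u x‖ ^ 2 + inner ℝ (u x) (G.X i (G.X i u) x))) := by
  have hXu := G.contDiff_X hu i
  have hs := (contDiff_regNormSq_rpow hu hδ (p / 2 - 1)).differentiable (by simp) x
  have hq := (hu.inner ℝ hXu).differentiable (by simp) x
  rw [funext (G.X_regPow hu hδ p i), G.X_const_mul (hs.fun_mul hq), G.X_mul hs hq,
    G.X_inner (hu.differentiable (by simp) x) (hXu.differentiable (by simp) x),
    G.X_rpow ((contDiff_regNormSq hu δ).differentiable (by simp) x) (regNormSq_pos hδ x),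
    G.X_regNormSq hu, real_inner_self_eq_norm_sq]
  rw [show p / 2 - 1 - 1 = p / 2 - 2 by ring]
  ring

/-- The horizontal energy density `|u| ^ (p - 4) |Re (ū ∇u)|²`, regularized. -/
noncomputable def regEnergy (u : (Fin n → ℝ) → ℂ) (δ p : ℝ) (x : Fin n → ℝ) : ℝ :=
  ∑ i with G.deg i = 1, regNormSq u δ x ^ (p / 2 - 2) * inner ℝ (u x) (G.X i u x) ^ 2

theorem continuous_regEnergy (hu : ContDiff ℝ ∞ u) (hδ : 0 < δ) (p : ℝ) :
    Continuous (G.regEnergy u δ p) :=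
  continuous_finsetSum _ fun i _ => (contDiff_regNormSq_rpow hu hδ _).continuous.mul
    ((hu.continuous.inner (G.contDiff_X hu i).continuous).pow 2)

theorem regEnergy_eq_zero {x : Fin n → ℝ} (hx : u x = 0) (p : ℝ) : G.regEnergy u δ p x = 0 := by
  simp [regEnergy, hx]

theorem hasCompactSupport_regEnergy (hc : HasCompactSupport u) (p : ℝ) :
    HasCompactSupport (G.regEnergy u δ p) :=
  hc.mono fun _ hx h => hx (G.regEnergy_eq_zero h p)

/-- With `s = |u|² + δ²`, Cauchy–Schwarz and `|u|² ≤ s` give `⟨u, X_i u⟩² ≤ s |X_i u|²`. This raises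
the coefficient `p - 2` of the energy in `X_i X_i` to `p - 1`, which is nonnegative for all `p ≥ 1`.
-/
theorem neg_subLaplacian_regPow_le (hu : ContDiff ℝ ∞ u) (hδ : 0 < δ) {p : ℝ} (hp : 1 ≤ p)
    (x : Fin n → ℝ) :
    -G.subLaplacian (regPow u δ p) x ≤ -(p * (p - 1) * G.regEnergy u δ p x)
      + p * (regNormSq u δ x ^ ((p - 1) / 2) * ‖G.subLaplacian u x‖) := by
  set s := regNormSq u δ x with hs
  have hspos : 0 < s := regNormSq_pos hδ x
  have hs1 : s ^ (p / 2 - 1) = s ^ (p / 2 - 2) * s := by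
    rw [← Real.rpow_add_one hspos.ne']
    ring_nf
  have hus : ‖u x‖ ^ 2 ≤ s := by
    rw [hs, regNormSq_eq]
    nlinarith [sq_nonneg δ]
  have hterm : ∀ i, p * (p - 1) * (s ^ (p / 2 - 2) * inner ℝ (u x) (G.X i u x) ^ 2)
      + p * (s ^ (p / 2 - 1) * inner ℝ (u x) (G.X i (G.X i u) x))
      ≤ G.X i (G.X i (regPow u δ p)) x := by
    intro i
    rw [G.X_X_regPow hu hδ, ← hs, hs1]
    have hcs : inner ℝ (u x) (G.X i u x) ^ 2 ≤ s * ‖G.X i u x‖ ^ 2 := by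
      calc inner ℝ (u x) (G.X i u x) ^ 2 ≤ (‖u x‖ * ‖G.X i u x‖) ^ 2 :=
            sq_le_sq' (neg_le_of_abs_le (abs_real_inner_le_norm _ _)) (real_inner_le_norm _ _)
        _ = ‖u x‖ ^ 2 * ‖G.X i u x‖ ^ 2 := by ring
        _ ≤ _ := by gcongr
    have hnn : 0 ≤ p * s ^ (p / 2 - 2) := by positivity
    nlinarith [mul_le_mul_of_nonneg_left hcs hnn]
  have hsum := Finset.sum_le_sum fun i (_ : i ∈ Finset.univ.filter fun i => G.deg i = 1) => hterm i
  rw [Finset.sum_add_distrib, ← Finset.mul_sum _ _ (p * (p - 1)), ← Finset.mul_sum _ _ p,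
    ← Finset.mul_sum _ _ (s ^ (p / 2 - 1)), ← inner_sum] at hsum
  have hsum' : p * (p - 1) * G.regEnergy u δ p x
      + p * (s ^ (p / 2 - 1) * inner ℝ (u x) (G.subLaplacian u x))
      ≤ G.subLaplacian (regPow u δ p) x := hsum
  have hs2 : s ^ ((p - 1) / 2) = s ^ (p / 2 - 1) * s ^ (1 / 2 : ℝ) := by
    rw [← Real.rpow_add hspos]
    ring_nf
  have hin : -(s ^ (1 / 2 : ℝ) * ‖G.subLaplacian u x‖) ≤ inner ℝ (u x) (G.subLaplacian u x) := by
    have h1 := neg_le_of_abs_le (abs_real_inner_le_norm (u x) (G.subLaplacian u x))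
    have h2 : ‖u x‖ ≤ s ^ (1 / 2 : ℝ) := by
      rw [← Real.sqrt_eq_rpow]
      exact Real.le_sqrt_of_sq_le hus
    nlinarith [mul_le_mul_of_nonneg_right h2 (norm_nonneg (G.subLaplacian u x))]
  have hnn : 0 ≤ p * s ^ (p / 2 - 1) := by positivity
  rw [hs2]
  nlinarith [mul_le_mul_of_nonneg_left hin hnn]

variable {v χ : (Fin n → ℝ) → ℝ} {σ : ℝ}

/-- Weighted arithmetic-geometric mean inequality: the square of `∇v` is absorbed by `-v 𝓛v`. The
term with `χ` pays for `s ^ (p / 2)` exceeding the regularized power by `δ ^ p`. -/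
theorem sum_X_mul_X_regPow_le (hu : ContDiff ℝ ∞ u) (hδ : 0 < δ) {p : ℝ}
    (hσ : 1 < σ) {x : Fin n → ℝ} (hvpos : 0 < v x)
    (hv : x ∈ tsupport χ → (σ - 1) * ∑ i with G.deg i = 1, G.X i v x ^ 2
      ≤ -(v x * G.subLaplacian v x))
    (hχ0 : 0 ≤ χ x) (hχ1 : ∀ y ∈ tsupport u, χ y = 1) :
    2 * ∑ i with G.deg i = 1, G.X i v x * G.X i (regPow u δ p) x
      ≤ -(G.subLaplacian v x * regPow u δ p x) + -((δ ^ 2) ^ (p / 2) * (G.subLaplacian v x * χ x))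
        + p ^ 2 / (σ - 1) * (v x * G.regEnergy u δ p x) := by
  have hσ' : 0 < σ - 1 := sub_pos.2 hσ
  have hneg : x ∈ tsupport χ → G.subLaplacian v x ≤ 0 := by
    intro hx
    have h1 : 0 ≤ (σ - 1) * ∑ i with G.deg i = 1, G.X i v x ^ 2 :=
      mul_nonneg hσ'.le (Finset.sum_nonneg fun _ _ => sq_nonneg _)
    have h2 := h1.trans (hv hx)
    by_contra! h
    nlinarith [mul_pos hvpos h]
  by_cases hxu : x ∈ tsupport u
  · have hxχ : x ∈ tsupport χ := subset_tsupport χ (by simp [hχ1 x hxu])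
    set s := regNormSq u δ x with hs
    have hspos : 0 < s := regNormSq_pos hδ x
    have hterm : ∀ i, 2 * (G.X i v x * G.X i (regPow u δ p) x)
        ≤ s ^ (p / 2) / v x * ((σ - 1) * G.X i v x ^ 2)
          + p ^ 2 / (σ - 1) * v x * (s ^ (p / 2 - 2) * inner ℝ (u x) (G.X i u x) ^ 2) := by
      intro i
      rw [G.X_regPow hu hδ, ← hs]
      have e1 : s ^ (p / 2 - 1) = s ^ (p / 2 - 2) * s := by
        rw [← Real.rpow_add_one hspos.ne']
        ring_nf
      have e2 : s ^ (p / 2) = s ^ (p / 2 - 2) * s ^ 2 := by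
        rw [← Real.rpow_natCast s 2, ← Real.rpow_add hspos]
        norm_num
      rw [e1, e2]
      set w := s ^ (p / 2 - 2)
      have hw : 0 < w := Real.rpow_pos_of_pos hspos _
      -- The weights are chosen so that the difference is a perfect square.
      have key : w * s ^ 2 / v x * ((σ - 1) * G.X i v x ^ 2)
          + p ^ 2 / (σ - 1) * v x * (w * inner ℝ (u x) (G.X i u x) ^ 2)
          - 2 * (G.X i v x * (p * (w * s * inner ℝ (u x) (G.X i u x))))
          = w / (v x * (σ - 1)) * (s * (σ - 1) * G.X i v x
            - p * v x * inner ℝ (u x) (G.X i u x)) ^ 2 := by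
        field_simp
        ring
      have : 0 ≤ w / (v x * (σ - 1)) * (s * (σ - 1) * G.X i v x
            - p * v x * inner ℝ (u x) (G.X i u x)) ^ 2 := by positivity
      linarith
    have hsum := Finset.sum_le_sum
      fun i (_ : i ∈ Finset.univ.filter fun i => G.deg i = 1) => hterm i
    rw [Finset.sum_add_distrib, ← Finset.mul_sum, ← Finset.mul_sum _ _ (s ^ (p / 2) / v x),
      ← Finset.mul_sum _ _ (σ - 1), ← Finset.mul_sum _ _ (p ^ 2 / (σ - 1) * v x)] at hsum
    have hgrad : s ^ (p / 2) / v x * ((σ - 1) * ∑ i with G.deg i = 1, G.X i v x ^ 2)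
        ≤ s ^ (p / 2) * -G.subLaplacian v x := by
      calc _ ≤ s ^ (p / 2) / v x * -(v x * G.subLaplacian v x) := by
            gcongr
            exact hv hxχ
        _ = _ := by field_simp
    have hreg : regPow u δ p x = s ^ (p / 2) + -(δ ^ 2) ^ (p / 2) := rfl
    rw [hχ1 x hxu, hreg]
    have hE : ∑ i with G.deg i = 1, s ^ (p / 2 - 2) * inner ℝ (u x) (G.X i u x) ^ 2
      = G.regEnergy u δ p x := rfl
    rw [hE] at hsum
    linarith
  -- Off the support of `u` only the cutoff term remains; it has the right sign because `𝓛v ≤ 0` on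
  -- the support of `χ`.
  · have h0 : u x = 0 := image_eq_zero_of_notMem_tsupport hxu
    have hz : ∑ i with G.deg i = 1, G.X i v x * G.X i (regPow u δ p) x = 0 :=
      Finset.sum_eq_zero fun i _ => by
        rw [G.X_eq_zero (fun h => hxu (tsupport_regPow_subset p h)), MulZeroClass.mul_zero]
    rw [hz, regPow_eq_zero h0, G.regEnergy_eq_zero h0]
    have hc : 0 ≤ (δ ^ 2) ^ (p / 2) := by positivity
    have : G.subLaplacian v x * χ x ≤ 0 := by
      by_cases hx : x ∈ tsupport χ
      · exact mul_nonpos_of_nonpos_of_nonneg (hneg hx) hχ0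
      · simp [image_eq_zero_of_notMem_tsupport hx]
    nlinarith [mul_nonneg hc (neg_nonneg.2 this)]

theorem integral_subLaplacian_mul (hv : ContDiff ℝ ∞ v) {g : (Fin n → ℝ) → ℝ}
    (hg : ContDiff ℝ ∞ g) (hc : HasCompactSupport g) :
    ∫ x, G.subLaplacian v x * g x = ∫ x, v x * G.subLaplacian g x ∧
      ∫ x, ∑ i with G.deg i = 1, G.X i v x * G.X i g x = -∫ x, v x * G.subLaplacian g x := by
  have hcX : ∀ i, HasCompactSupport (G.X i g) := fun i => hc.mono' (G.support_X_subset g i)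
  have hcXX : ∀ i, HasCompactSupport (G.X i (G.X i g)) := fun i =>
    (hcX i).mono' (G.support_X_subset _ i)
  have hXv := G.contDiff_X hv
  have hXg := G.contDiff_X hg
  simp only [subLaplacian, Finset.mul_sum, Finset.sum_mul]
  rw [integral_finsetSum, integral_finsetSum, integral_finsetSum]
  · simp only [G.integral_mul_X_X hv hg hc, G.integral_X_X_mul hv hg hc, Finset.sum_neg_distrib,
      neg_neg, and_self]
  · exact fun i _ => ((hXv i).continuous.mul (hXg i).continuous).integrable_of_hasCompactSupport
      (hcX i).mul_left
  · exact fun i _ => (hv.continuous.mul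
      (G.contDiff_X (hXg i) i).continuous).integrable_of_hasCompactSupport (hcXX i).mul_left
  · exact fun i _ => ((G.contDiff_X (hXv i) i).continuous.mul
      hg.continuous).integrable_of_hasCompactSupport hc.mul_left

/-- The weighted inequality for a smooth weight, before the limit `δ → 0`. -/
theorem integral_regPow_le_of_contDiff (hu : ContDiff ℝ ∞ u) (huc : HasCompactSupport u)
    (hδ : 0 < δ) {p : ℝ} (hp : 1 ≤ p) (hσ : 1 < σ) (hv : ContDiff ℝ ∞ v) (hvpos : ∀ x, 0 < v x)
    (hvσ : ∀ x ∈ tsupport χ, (σ - 1) * ∑ i with G.deg i = 1, G.X i v x ^ 2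
      ≤ -(v x * G.subLaplacian v x))
    (hχ : ContDiff ℝ ∞ χ) (hχc : HasCompactSupport χ) (hχ0 : ∀ x, 0 ≤ χ x)
    (hχ1 : ∀ y ∈ tsupport u, χ y = 1) :
    ((p - 1) * σ + 1) / p * -∫ x, v x * G.subLaplacian (regPow u δ p) x
      ≤ (p - 1) * (σ - 1) / p * (δ ^ 2) ^ (p / 2) * -(∫ x, v x * G.subLaplacian χ x)
        + p * ∫ x, v x * (regNormSq u δ x ^ ((p - 1) / 2) * ‖G.subLaplacian u x‖) := by
  have hg := contDiff_regPow hu hδ p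
  have hgc : HasCompactSupport (regPow u δ p) :=
    huc.mono fun x hx h => hx (regPow_eq_zero h p)
  have hLv := (G.contDiff_subLaplacian hv).continuous
  have hLg := (G.contDiff_subLaplacian hg).continuous
  have hiE : Integrable fun x => v x * G.regEnergy u δ p x :=
    (hv.continuous.mul (G.continuous_regEnergy hu hδ p)).integrable_of_hasCompactSupport
      (G.hasCompactSupport_regEnergy huc p).mul_left
  have hiLg : Integrable fun x => v x * G.subLaplacian (regPow u δ p) x :=
    (hv.continuous.mul hLg).integrable_of_hasCompactSupport
      (hgc.mono' (G.support_subLaplacian_subset _)).mul_left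
  have hiR : Integrable fun x =>
      v x * (regNormSq u δ x ^ ((p - 1) / 2) * ‖G.subLaplacian u x‖) := by
    refine (hv.continuous.mul ((contDiff_regNormSq_rpow hu hδ _).continuous.mul
      (G.contDiff_subLaplacian hu).continuous.norm)).integrable_of_hasCompactSupport ?_
    exact HasCompactSupport.mul_left (HasCompactSupport.mul_left
      (huc.mono' (G.support_subLaplacian_subset _)).norm)
  have hig : Integrable fun x => G.subLaplacian v x * regPow u δ p x :=
    (hLv.mul hg.continuous).integrable_of_hasCompactSupport hgc.mul_left
  have hiχ : Integrable fun x => G.subLaplacian v x * χ x :=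
    (hLv.mul hχ.continuous).integrable_of_hasCompactSupport hχc.mul_left
  have hiS : Integrable fun x => ∑ i with G.deg i = 1, G.X i v x * G.X i (regPow u δ p) x :=
    integrable_finsetSum _ fun i _ => ((G.contDiff_X hv i).continuous.mul
      (G.contDiff_X hg i).continuous).integrable_of_hasCompactSupport
        (hgc.mono' (G.support_X_subset _ i)).mul_left
  have h1 : -∫ x, v x * G.subLaplacian (regPow u δ p) x
      ≤ -(p * (p - 1) * ∫ x, v x * G.regEnergy u δ p x)
        + p * ∫ x, v x * (regNormSq u δ x ^ ((p - 1) / 2) * ‖G.subLaplacian u x‖) := by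
    rw [← integral_neg, ← integral_const_mul, ← integral_const_mul, ← integral_neg,
      ← integral_add (hiE.const_mul _).fun_neg (hiR.const_mul _)]
    refine integral_mono hiLg.neg ((hiE.const_mul _).fun_neg.add (hiR.const_mul _)) fun x => ?_
    have := mul_le_mul_of_nonneg_left (G.neg_subLaplacian_regPow_le hu hδ hp x) (hvpos x).le
    beta_reduce
    linarith
  obtain ⟨e1, e2⟩ := G.integral_subLaplacian_mul hv hg hgc
  have e3 := (G.integral_subLaplacian_mul hv hχ hχc).1
  have h2 : 2 * ∫ x, ∑ i with G.deg i = 1, G.X i v x * G.X i (regPow u δ p) x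
      ≤ -(∫ x, G.subLaplacian v x * regPow u δ p x)
        + -((δ ^ 2) ^ (p / 2) * ∫ x, G.subLaplacian v x * χ x)
        + p ^ 2 / (σ - 1) * ∫ x, v x * G.regEnergy u δ p x := by
    rw [← integral_const_mul, ← integral_const_mul, ← integral_const_mul, ← integral_neg,
      ← integral_neg, ← integral_add hig.fun_neg (hiχ.const_mul _).fun_neg,
      ← integral_add (hig.fun_neg.fun_add (hiχ.const_mul _).fun_neg) (hiE.const_mul _)]
    exact integral_mono (hiS.const_mul _)
      ((hig.fun_neg.fun_add (hiχ.const_mul _).fun_neg).add (hiE.const_mul _)) fun x =>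
        G.sum_X_mul_X_regPow_le hu hδ hσ (hvpos x) (hvσ x) (hχ0 x) hχ1
  rw [e1, e2, e3] at h2
  set A := ∫ x, v x * G.subLaplacian (regPow u δ p) x
  set B := ∫ x, v x * G.subLaplacian χ x
  set D := ∫ x, v x * G.regEnergy u δ p x
  set c := (δ ^ 2) ^ (p / 2)
  have hp0 : 0 < p := by linarith
  have hσ' : 0 < σ - 1 := sub_pos.2 hσ
  -- After integration by parts the left side of `h2` is `-2A`, and one `-A` from the right is
  -- absorbed.
  have h3 : -A ≤ -(c * B) + p ^ 2 / (σ - 1) * D := by linarith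
  -- The multiplier turns the coefficient of `D` into `p (p - 1)`, which cancels the energy in `h1`.
  have h4 : (p - 1) * (σ - 1) / p * -A
      ≤ (p - 1) * (σ - 1) / p * (-(c * B)) + p * (p - 1) * D := by
    calc _ ≤ (p - 1) * (σ - 1) / p * (-(c * B) + p ^ 2 / (σ - 1) * D) := by
          refine mul_le_mul_of_nonneg_left h3 ?_
          exact div_nonneg (mul_nonneg (by linarith) hσ'.le) hp0.le
      _ = _ := by field_simp
  have e4 : ((p - 1) * σ + 1) / p = 1 + (p - 1) * (σ - 1) / p := by
    field_simp
    ring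
  rw [e4]
  linarith

/-- A power `f ^ (1 / σ)` of a superharmonic function satisfies `(σ - 1) |∇v|² ≤ -v 𝓛v`. -/
theorem gradient_sq_le_of_rpow {f : (Fin n → ℝ) → ℝ} (hf : ContDiff ℝ ∞ f) (hpos : ∀ x, 0 < f x)
    (hσ : 1 < σ) {x : Fin n → ℝ} (hx : G.subLaplacian f x ≤ 0) :
    (σ - 1) * ∑ i with G.deg i = 1, G.X i (fun y => f y ^ (1 / σ)) x ^ 2
      ≤ -(f x ^ (1 / σ) * G.subLaplacian (fun y => f y ^ (1 / σ)) x) := by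
  set a := 1 / σ with ha
  have hσ0 : 0 < σ := by linarith
  have ha0 : 0 < a := by positivity
  have hσa : σ * a = 1 := by
    rw [ha]
    field_simp
  have hd := hf.differentiable (by simp)
  have hX : ∀ i, G.X i (fun y => f y ^ a) = fun y => a * (f y ^ (a - 1) * G.X i f y) :=
    fun i => funext fun y => by rw [G.X_rpow (hd y) (hpos y), _root_.mul_assoc]
  have hXX : ∀ i, G.X i (G.X i (fun y => f y ^ a)) x
      = a * f x ^ (a - 1) * G.X i (G.X i f) x
        + a * (a - 1) * f x ^ (a - 1 - 1) * G.X i f x ^ 2 := by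
    intro i
    have h1 : DifferentiableAt ℝ (fun y => f y ^ (a - 1)) x :=
      (hf.rpow_const_of_ne fun y => (hpos y).ne').differentiable (by simp) x
    have h2 := (G.contDiff_X hf i).differentiable (by simp) x
    rw [hX, G.X_const_mul (h1.fun_mul h2), G.X_mul h1 h2, G.X_rpow (hd x) (hpos x)]
    ring
  have hL : G.subLaplacian (fun y => f y ^ a) x = a * f x ^ (a - 1) * G.subLaplacian f x
      + a * (a - 1) * f x ^ (a - 1 - 1) * ∑ i with G.deg i = 1, G.X i f x ^ 2 := by
    simp only [subLaplacian, hXX, Finset.sum_add_distrib, Finset.mul_sum]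
  have hgrad : ∑ i with G.deg i = 1, G.X i (fun y => f y ^ a) x ^ 2
      = a ^ 2 * f x ^ (a - 1) ^ 1 * f x ^ (a - 1) * ∑ i with G.deg i = 1, G.X i f x ^ 2 := by
    rw [Finset.mul_sum]
    refine Finset.sum_congr rfl fun i _ => ?_
    rw [hX]
    ring_nf
  have e1 : f x ^ (a - 1) = f x ^ (a - 1 - 1) * f x := by
    rw [← Real.rpow_add_one (hpos x).ne']
    ring_nf
  have e2 : f x ^ a = f x ^ (a - 1 - 1) * f x ^ 2 := by
    rw [← Real.rpow_natCast (f x) 2, ← Real.rpow_add (hpos x)]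
    ring_nf
  rw [hgrad, hL, pow_one, e1, e2]
  set w := f x ^ (a - 1 - 1)
  set S := ∑ i with G.deg i = 1, G.X i f x ^ 2
  have hw : 0 < w := Real.rpow_pos_of_pos (hpos x) _
  have hfx := hpos x
  have h1 : 0 ≤ a * w ^ 2 * f x ^ 3 * -G.subLaplacian f x :=
    mul_nonneg (by positivity) (neg_nonneg.2 hx)
  -- Since `σ a = 1`, `(σ - 1) a² = a (1 - a)`: the gradient terms on the two sides coincide and
  -- only the term with `𝓛f ≤ 0` is left.
  have h2 : (σ - 1) * (a ^ 2 * (w * f x) * (w * f x) * S)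
      = (σ * a - a) * a * w ^ 2 * f x ^ 2 * S := by ring
  rw [h2, hσa]
  linarith

end CarnotGroup

/-! ### Mollification of the weight. -/

namespace CarnotGroup

variable {n : ℕ} (G : CarnotGroup n)

theorem continuous_inv_mul (x : Fin n → ℝ) : Continuous fun y => G.mul (G.inv y) x :=
  (G.contDiff_mul_comp G.contDiff_inv contDiff_const).continuous

/-- With `y = x ∘ z⁻¹` this reads `z = y⁻¹ ∘ x`: the mollification averages `w` over small left
translates of `x`. -/
theorem inv_mul_inv_mul (x z : Fin n → ℝ) : G.mul (G.inv (G.mul x (G.inv z))) x = z := by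
  rw [G.inv_mul_rev, G.inv_inv, G.mul_assoc, G.inv_mul, G.mul_zero]

/-- Group mollifications of a weakly superharmonic function are superharmonic. -/
theorem subLaplacian_mollify_nonpos {Ω K : Set (Fin n → ℝ)} (hΩ : IsOpen Ω) (hK : IsCompact K)
    (hKΩ : K ⊆ Ω) {w ψ : (Fin n → ℝ) → ℝ} (hw : IntegrableOn w K)
    (hwL : G.WeakSubLaplacianNonpos Ω w) (hψ : ContDiff ℝ ∞ ψ) (hψ0 : ∀ y, 0 ≤ ψ y)
    {x : Fin n → ℝ} (hx : ∀ z, ψ (G.mul x (G.inv z)) ≠ 0 → z ∈ K) :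
    G.subLaplacian (fun x => ∫ z in K, w z • ψ (G.mul x (G.inv z))) x ≤ 0 := by
  rw [G.subLaplacian_setIntegral (F := fun x z => ψ (G.mul x (G.inv z))) (G.contDiff_kernel hψ)
    hK hw]
  simp only [G.subLaplacian_kernel hψ, smul_eq_mul]
  have hts : tsupport (fun z => ψ (G.mul x (G.inv z))) ⊆ K :=
    closure_minimal (fun z hz => hx z hz) hK.isClosed
  rw [← setIntegral_eq_of_subset_of_forall_sdiff_eq_zero hΩ.measurableSet hKΩ]
  · refine hwL _ ⟨?_, hK.of_isClosed_subset (isClosed_tsupport _) hts, hts.trans hKΩ⟩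
      fun z => hψ0 _
    exact hψ.comp (G.contDiff_mul_comp contDiff_const G.contDiff_inv)
  · intro z hz
    rw [G.subLaplacian_eq_zero fun h => hz.2 (hts h), MulZeroClass.mul_zero]

theorem setIntegral_kernel {K : Set (Fin n → ℝ)} {ψ : (Fin n → ℝ) → ℝ} (hψ1 : ∫ y, ψ y = 1)
    {x : Fin n → ℝ} (hx : ∀ z, ψ (G.mul x (G.inv z)) ≠ 0 → z ∈ K) :
    ∫ z in K, ψ (G.mul x (G.inv z)) = 1 := by
  rw [setIntegral_eq_integral_of_forall_compl_eq_zero, G.integral_comp_mul_inv, hψ1]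
  intro z hz
  by_contra h
  exact hz (hx z h)

/-- The kernel is a probability density in `z`. The case `c = 0` gives the uniform bound and `c = w
x` the convergence. -/
theorem abs_mollify_sub_le {K : Set (Fin n → ℝ)} (hK : IsCompact K)
    {w ψ : (Fin n → ℝ) → ℝ} (hw : IntegrableOn w K) (hψ : Continuous ψ) (hψ0 : ∀ y, 0 ≤ ψ y)
    (hψ1 : ∫ y, ψ y = 1) {x : Fin n → ℝ} (hx : ∀ z, ψ (G.mul x (G.inv z)) ≠ 0 → z ∈ K)
    {c η : ℝ} (hc : ∀ z ∈ K, ψ (G.mul x (G.inv z)) ≠ 0 → |w z - c| ≤ η) :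
    |(∫ z in K, w z • ψ (G.mul x (G.inv z))) - c| ≤ η := by
  have hk : Continuous fun z => ψ (G.mul x (G.inv z)) :=
    hψ.comp (G.contDiff_mul_comp contDiff_const G.contDiff_inv).continuous
  have hki : IntegrableOn (fun z => ψ (G.mul x (G.inv z))) K :=
    hk.continuousOn.integrableOn_compact hK
  have h1 := G.setIntegral_kernel hψ1 hx
  have e : (∫ z in K, w z • ψ (G.mul x (G.inv z))) - c
      = ∫ z in K, (w z - c) * ψ (G.mul x (G.inv z)) := by
    simp only [sub_mul, smul_eq_mul]
    have hwk : IntegrableOn (fun z => w z * ψ (G.mul x (G.inv z))) K :=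
      hw.smul_continuousOn hk.continuousOn hK
    rw [integral_sub hwk (hki.const_mul c),
      integral_const_mul, h1, mul_one]
  rw [e, ← Real.norm_eq_abs]
  calc _ ≤ ∫ z in K, η * ψ (G.mul x (G.inv z)) := by
        refine norm_integral_le_of_norm_le (hki.const_mul η) ?_
        filter_upwards [ae_restrict_mem hK.measurableSet] with z hz
        rw [norm_mul, Real.norm_eq_abs, Real.norm_eq_abs, abs_of_nonneg (hψ0 _)]
        by_cases h : ψ (G.mul x (G.inv z)) = 0
        · simp [h]
        · exact mul_le_mul_of_nonneg_right (hc z hz h) (hψ0 _)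
    _ = η := by rw [integral_const_mul, h1, mul_one]

/-- A compact neighbourhood of a compact subset of `Ω` that absorbs small left translations. -/
theorem exists_compact_translates {Ω K : Set (Fin n → ℝ)} (hΩ : IsOpen Ω) (hK : IsCompact K)
    (hKΩ : K ⊆ Ω) : ∃ ε > 0, ∃ K' ⊆ Ω, IsCompact K' ∧
      ∀ y ∈ Metric.closedBall (0 : Fin n → ℝ) ε, ∀ x ∈ K, G.mul (G.inv y) x ∈ K' := by
  have hcont : Continuous fun q : (Fin n → ℝ) × (Fin n → ℝ) => G.mul (G.inv q.1) q.2 :=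
    (G.contDiff_mul_comp (G.contDiff_inv.comp contDiff_fst) contDiff_snd).continuous
  obtain ⟨U, T, hU, -, h0U, hKT, hUT⟩ := generalized_tube_lemma (isCompact_singleton (x := 0)) hK
    (hΩ.preimage hcont) (by
      rintro ⟨y, x⟩ ⟨hy, hx⟩
      rw [Set.mem_singleton_iff] at hy
      simp only [Set.mem_preimage] at hx ⊢
      rw [show y = 0 from hy, G.inv_zero, G.zero_mul]
      exact hKΩ hx)
  obtain ⟨ε, hε, hball⟩ := Metric.nhds_basis_closedBall.mem_iff.1
    (hU.mem_nhds (Set.singleton_subset_iff.1 h0U))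
  refine ⟨ε, hε, (fun q : (Fin n → ℝ) × (Fin n → ℝ) => G.mul (G.inv q.1) q.2) ''
    (Metric.closedBall 0 ε ×ˢ K), ?_, ((isCompact_closedBall 0 ε).prod hK).image hcont,
    fun y hy x hx => ⟨(y, x), ⟨hy, hx⟩, rfl⟩⟩
  rintro _ ⟨q, ⟨hq1, hq2⟩, rfl⟩
  exact hUT ⟨hball hq1, hKT hq2⟩

/-- Approximation of a weight by smooth weights that satisfy the differential inequality
`(σ - 1) |∇v|² ≤ -v 𝓛v`. -/
theorem exists_smooth_approx {Ω K : Set (Fin n → ℝ)} (hΩ : IsOpen Ω) (hK : IsCompact K)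
    (hKΩ : K ⊆ Ω) {V : (Fin n → ℝ) → ℝ} {σ : ℝ} (hσ : 1 < σ) (hV : ContinuousOn V Ω)
    (hVpos : ∀ x ∈ Ω, 0 < V x) (hVσ : G.WeakSubLaplacianNonpos Ω (fun x => V x ^ σ)) :
    ∃ v : ℕ → (Fin n → ℝ) → ℝ, (∀ j, ContDiff ℝ ∞ (v j)) ∧ (∀ j x, 0 < v j x) ∧
      (∀ j, ∀ x ∈ K, (σ - 1) * ∑ i with G.deg i = 1, G.X i (v j) x ^ 2
        ≤ -(v j x * G.subLaplacian (v j) x)) ∧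
      (∃ C, ∀ j, ∀ x ∈ K, v j x ≤ C) ∧
      ∀ x ∈ K, Tendsto (fun j => v j x) atTop (𝓝 (V x)) := by
  obtain ⟨ε, hε, K', hK'Ω, hK', htr⟩ := G.exists_compact_translates hΩ hK hKΩ
  have hσ0 : 0 < σ := by linarith
  set w : (Fin n → ℝ) → ℝ := fun x => V x ^ σ with hwdef
  have hwc : ContinuousOn w Ω := hV.rpow_const fun x _ => Or.inr hσ0.le
  have hw : IntegrableOn w K' := (hwc.mono hK'Ω).integrableOn_compact hK'
  have hw0 : ∀ z ∈ K', 0 ≤ w z := fun z hz => Real.rpow_nonneg (hVpos z (hK'Ω hz)).le _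
  obtain ⟨M, hM⟩ := hK'.exists_bound_of_continuousOn (hwc.mono hK'Ω)
  -- The outer radii are at most `ε`, so a single `K'` serves all `j`, and they tend to `0`.
  let φ : ℕ → ContDiffBump (0 : Fin n → ℝ) := fun j =>
    ⟨ε / (j + 1) / 2, ε / (j + 1), by positivity, half_lt_self (by positivity)⟩
  let ψ : ℕ → (Fin n → ℝ) → ℝ := fun j => (φ j).normed volume
  have hψ : ∀ j, ContDiff ℝ ∞ (ψ j) := fun j => (φ j).contDiff_normed
  have hψ0 : ∀ j y, 0 ≤ ψ j y := fun j y => (φ j).nonneg_normed y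
  have hψ1 : ∀ j, ∫ y, ψ j y = 1 := fun j => (φ j).integral_normed
  have hψs : ∀ j y, ψ j y ≠ 0 → dist y 0 < ε / (j + 1) := fun j y hy => by
    have : y ∈ Function.support ((φ j).normed volume) := hy
    rw [(φ j).support_normed_eq] at this
    exact this
  have hψK : ∀ j, ∀ x ∈ K, ∀ z, ψ j (G.mul x (G.inv z)) ≠ 0 → z ∈ K' := by
    intro j x hx z hz
    rw [← G.inv_mul_inv_mul x z]
    refine htr _ ?_ x hx
    rw [Metric.mem_closedBall]
    refine (hψs j _ hz).le.trans (div_le_self hε.le ?_)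
    have : (0 : ℝ) ≤ j := j.cast_nonneg
    linarith
  -- The added constant makes `f j` positive on the whole space, hence its `1 / σ`-th power smooth,
  -- and is invisible to `𝓛`.
  let f : ℕ → (Fin n → ℝ) → ℝ := fun j x =>
    (∫ z in K', w z • ψ j (G.mul x (G.inv z))) + 1 / ((j : ℝ) + 1)
  have hf : ∀ j, ContDiff ℝ ∞ (f j) := fun j =>
    (contDiff_infty.2 fun m => contDiff_setIntegral_smul hK' hw m
      (F := fun x z => ψ j (G.mul x (G.inv z))) (G.contDiff_kernel (hψ j))).add contDiff_const
  have hfpos : ∀ j x, 0 < f j x := fun j x => by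
    have : 0 ≤ ∫ z in K', w z • ψ j (G.mul x (G.inv z)) :=
      setIntegral_nonneg hK'.measurableSet fun z hz => mul_nonneg (hw0 z hz) (hψ0 j _)
    positivity
  have hfL : ∀ j, ∀ x ∈ K, G.subLaplacian (f j) x ≤ 0 := by
    intro j x hx
    rw [show f j = fun x => (∫ z in K', w z • ψ j (G.mul x (G.inv z))) + 1 / ((j : ℝ) + 1) from rfl,
      G.subLaplacian_add_const]
    exact G.subLaplacian_mollify_nonpos hΩ hK' hK'Ω hw hVσ (hψ j) (hψ0 j) (hψK j x hx)
  have hone : ∀ j : ℕ, 1 / ((j : ℝ) + 1) ≤ 1 := fun j => by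
    rw [div_le_one (by positivity)]
    have : (0 : ℝ) ≤ j := j.cast_nonneg
    linarith
  have hfM : ∀ j, ∀ x ∈ K, f j x ≤ M + 1 := by
    intro j x hx
    have := G.abs_mollify_sub_le hK' hw (hψ j).continuous (hψ0 j) (hψ1 j) (hψK j x hx)
      (c := 0) (η := M) fun z hz _ => by simpa using hM z hz
    rw [sub_zero] at this
    exact add_le_add (le_of_abs_le this) (hone j)
  have hflim : ∀ x ∈ K, Tendsto (fun j => f j x) atTop (𝓝 (w x)) := by
    intro x hx
    rw [← add_zero (w x)]
    refine Tendsto.add ?_ tendsto_one_div_add_atTop_nhds_zero_nat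
    rw [Metric.tendsto_atTop']
    intro η hη
    have hat : ContinuousAt (fun y : Fin n → ℝ => w (G.mul (G.inv y) x)) 0 := by
      refine ContinuousAt.comp (f := fun y => G.mul (G.inv y) x) (g := w) ?_
        (G.continuous_inv_mul x).continuousAt
      rw [G.inv_zero, G.zero_mul]
      exact hwc.continuousAt (hΩ.mem_nhds (hKΩ hx))
    obtain ⟨r, hr, hball⟩ := Metric.continuousAt_iff.1 hat (η / 2) (by positivity)
    have hlim : Tendsto (fun j : ℕ => ε / ((j : ℝ) + 1)) atTop (𝓝 0) := by
      simpa [div_eq_mul_inv] using tendsto_one_div_add_atTop_nhds_zero_nat.const_mul ε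
    obtain ⟨N, hN⟩ := eventually_atTop.1 (hlim.eventually (gt_mem_nhds hr))
    refine ⟨N, fun j hj => ?_⟩
    refine lt_of_le_of_lt ?_ (half_lt_self hη)
    refine G.abs_mollify_sub_le hK' hw (hψ j).continuous (hψ0 j) (hψ1 j) (hψK j x hx)
      fun z _ hz => ?_
    have := hball ((hψs j _ hz).trans (hN j hj.le))
    rw [G.inv_mul_inv_mul, G.inv_zero, G.zero_mul] at this
    exact this.le
  refine ⟨fun j x => f j x ^ (1 / σ), fun j => (hf j).rpow_const_of_ne fun x => (hfpos j x).ne',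
    fun j x => Real.rpow_pos_of_pos (hfpos j x) _,
    fun j x hx => G.gradient_sq_le_of_rpow (hf j) (hfpos j) hσ (hfL j x hx),
    ⟨(M + 1) ^ (1 / σ), fun j x hx => Real.rpow_le_rpow (hfpos j x).le (hfM j x hx)
      (by positivity)⟩, fun x hx => ?_⟩
  have hVx : V x = w x ^ (1 / σ) := by
    rw [hwdef, ← Real.rpow_mul (hVpos x (hKΩ hx)).le, mul_one_div_cancel hσ0.ne', Real.rpow_one]
  rw [hVx]
  exact (hflim x hx).rpow_const (Or.inr (by positivity))

/-- Smooth cutoff functions. -/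
theorem exists_cutoff {Ω K : Set (Fin n → ℝ)} (hΩ : IsOpen Ω) (hK : IsCompact K) (hKΩ : K ⊆ Ω) :
    ∃ χ : (Fin n → ℝ) → ℝ, IsTestFunction Ω χ ∧ (∀ x, 0 ≤ χ x) ∧ ∀ x ∈ K, χ x = 1 := by
  obtain ⟨L, hL, hKL, hLΩ⟩ := exists_compact_between hK hΩ hKΩ
  obtain ⟨χ, hχ, hrange, hsupp, hone⟩ := exists_contMDiff_support_eq_eq_one_iff
    (n := ⊤) (modelWithCornersSelf ℝ (Fin n → ℝ)) isOpen_interior hK.isClosed hKL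
  have hts : tsupport χ ⊆ L := by
    rw [tsupport, hsupp]
    exact closure_minimal interior_subset hL.isClosed
  exact ⟨χ, ⟨hχ.contDiff, hL.of_isClosed_subset (isClosed_tsupport _) hts, hts.trans hLΩ⟩,
    fun x => (hrange ⟨x, rfl⟩).1, fun x hx => (hone x).1 hx⟩

end CarnotGroup

/-! ### Hölder's inequality and the division by the left-hand side. -/

theorem ENNReal.rpow_inv_le_of_le_mul_rpow {I C R : ENNReal} {p : ℝ} (hp : 1 ≤ p) (hI : I ≠ ⊤)
    (h : I ≤ C * (I ^ ((p - 1) / p) * R)) : I ^ (1 / p) ≤ C * R := by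
  have hp0 : 0 < p := by linarith
  rcases eq_or_ne I 0 with rfl | h0
  · rw [ENNReal.zero_rpow_of_pos (by positivity : 0 < 1 / p)]
    exact zero_le
  have hz : I ^ ((p - 1) / p) ≠ 0 := by simp [ENNReal.rpow_eq_zero_iff, h0, hI]
  have ht : I ^ ((p - 1) / p) ≠ ⊤ := ENNReal.rpow_ne_top_of_nonneg
    (div_nonneg (by linarith) hp0.le) hI
  rw [← ENNReal.mul_le_mul_iff_right hz ht]
  calc I ^ ((p - 1) / p) * I ^ (1 / p) = I := by
        rw [← ENNReal.rpow_add _ _ h0 hI, ← add_div, sub_add_cancel, div_self hp0.ne',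
          ENNReal.rpow_one]
    _ ≤ _ := h
    _ = _ := by ring

/-- Hölder's inequality for `a ^ ((p - 1) / p) b ^ (p - 1)` and `c / a ^ ((p - 1) / p)`. -/
theorem lintegral_mul_rpow_le {α : Type*} [MeasurableSpace α] {μ : Measure α} {p : ℝ} (hp : 1 ≤ p)
    {a b c : α → ℝ} (ha : AEMeasurable a μ) (hb : AEMeasurable b μ) (hc : AEMeasurable c μ)
    (ha0 : ∀ᵐ x ∂μ, 0 < a x) (hb0 : ∀ x, 0 ≤ b x) (hc0 : ∀ᵐ x ∂μ, 0 ≤ c x) :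
    ∫⁻ x, ENNReal.ofReal (c x * b x ^ (p - 1)) ∂μ
      ≤ (∫⁻ x, ENNReal.ofReal (a x * b x ^ p) ∂μ) ^ ((p - 1) / p)
        * (∫⁻ x, ENNReal.ofReal ((c x / a x ^ ((p - 1) / p)) ^ p) ∂μ) ^ (1 / p) := by
  have hp0 : 0 < p := by linarith
  -- For `p = 1` there is no finite conjugate exponent, but both sides agree.
  rcases hp.eq_or_lt with rfl | hp1
  · simp
  have hpq := Real.HolderConjugate.conjExponent hp1
  have hq : p.conjExponent = p / (p - 1) := rfl
  have hq0 : 0 < p.conjExponent := hpq.symm.pos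
  have hp1' : 0 < p - 1 := by linarith
  have hH := ENNReal.lintegral_mul_le_Lp_mul_Lq μ hpq
    (f := fun x => ENNReal.ofReal (c x / a x ^ ((p - 1) / p)))
    (g := fun x => ENNReal.ofReal (a x ^ ((p - 1) / p) * b x ^ (p - 1)))
    (hc.div (ha.pow_const _)).ennreal_ofReal
    ((ha.pow_const _).mul (hb.pow_const _)).ennreal_ofReal
  have e1 : ∫⁻ x, ENNReal.ofReal (c x * b x ^ (p - 1)) ∂μ
      = ∫⁻ x, ((fun x => ENNReal.ofReal (c x / a x ^ ((p - 1) / p)))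
        * fun x => ENNReal.ofReal (a x ^ ((p - 1) / p) * b x ^ (p - 1))) x ∂μ := by
    refine lintegral_congr_ae ?_
    filter_upwards [ha0, hc0] with x hx hcx
    have hpos : 0 < a x ^ ((p - 1) / p) := Real.rpow_pos_of_pos hx _
    rw [Pi.mul_apply, ← ENNReal.ofReal_mul (by positivity)]
    congr 1
    field_simp
  have e2 : ∫⁻ x, ENNReal.ofReal (c x / a x ^ ((p - 1) / p)) ^ p ∂μ
      = ∫⁻ x, ENNReal.ofReal ((c x / a x ^ ((p - 1) / p)) ^ p) ∂μ := by
    refine lintegral_congr_ae ?_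
    filter_upwards [ha0, hc0] with x hx hcx
    exact ENNReal.ofReal_rpow_of_nonneg (by positivity) hp0.le
  have e3 : ∫⁻ x, ENNReal.ofReal (a x ^ ((p - 1) / p) * b x ^ (p - 1)) ^ p.conjExponent ∂μ
      = ∫⁻ x, ENNReal.ofReal (a x * b x ^ p) ∂μ := by
    refine lintegral_congr_ae ?_
    filter_upwards [ha0] with x hx
    have hbx := hb0 x
    rw [ENNReal.ofReal_rpow_of_nonneg (by positivity) hq0.le,
      Real.mul_rpow (by positivity) (by positivity), ← Real.rpow_mul hx.le, ← Real.rpow_mul hbx, hq,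
      div_mul_div_cancel₀' hp1'.ne', div_self hp0.ne', mul_div_cancel₀ _ hp1'.ne', Real.rpow_one]
  rw [e2, e3, hq, one_div_div, mul_comm (_ ^ (1 / p))] at hH
  rwa [e1]

/-! ### Limits in the weight and in `δ`. -/

namespace CarnotGroup

variable {n : ℕ} (G : CarnotGroup n)

/-- Dominated convergence. The approximating weights are controlled only on `K`, so `h` must vanish
off `K`. -/
theorem tendsto_integral_mul {Ω K : Set (Fin n → ℝ)} (hΩ : IsOpen Ω) (hK : IsCompact K)
    (hKΩ : K ⊆ Ω) {V : (Fin n → ℝ) → ℝ} {v : ℕ → (Fin n → ℝ) → ℝ} (hv : ∀ j, Continuous (v j))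
    {C : ℝ} (hC : ∀ j, ∀ x ∈ K, |v j x| ≤ C)
    (hlim : ∀ x ∈ K, Tendsto (fun j => v j x) atTop (𝓝 (V x))) {h : (Fin n → ℝ) → ℝ}
    (hh : Continuous h) (hs : ∀ x ∉ K, h x = 0) :
    Tendsto (fun j => ∫ x, v j x * h x) atTop (𝓝 (∫ x in Ω, V x * h x)) := by
  rw [setIntegral_eq_of_subset_of_forall_sdiff_eq_zero hΩ.measurableSet hKΩ
    fun x hx => by rw [hs x hx.2, MulZeroClass.mul_zero]]
  have e : ∀ j, ∫ x, v j x * h x = ∫ x in K, v j x * h x := fun j =>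
    (setIntegral_eq_integral_of_forall_compl_eq_zero fun x hx => by
      rw [hs x hx, MulZeroClass.mul_zero]).symm
  simp only [e]
  refine tendsto_integral_of_dominated_convergence (fun x => C * ‖h x‖)
    (fun j => ((hv j).mul hh).aestronglyMeasurable)
    ((hh.norm.continuousOn.integrableOn_compact hK).const_mul C) (fun j => ?_) ?_
  · filter_upwards [ae_restrict_mem hK.measurableSet] with x hx
    rw [norm_mul]
    gcongr
    exact hC j x hx
  · filter_upwards [ae_restrict_mem hK.measurableSet] with x hx
    exact (hlim x hx).mul_const _

variable {Ω : Set (Fin n → ℝ)} {V LV : (Fin n → ℝ) → ℝ} {σ : ℝ} {u : (Fin n → ℝ) → ℂ}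

/-- The weighted inequality for a weak weight, before the limit `δ → 0`. -/
theorem integral_regPow_le (hΩ : IsOpen Ω) (hσ : 1 < σ)
    (hV : ContinuousOn V Ω) (hVpos : ∀ x ∈ Ω, 0 < V x) (hLV : G.HasWeakSubLaplacian Ω V LV)
    (hVσ : G.WeakSubLaplacianNonpos Ω (fun x => V x ^ σ)) (hu : IsTestFunction Ω u)
    {χ : (Fin n → ℝ) → ℝ} (hχ : IsTestFunction Ω χ) (hχ0 : ∀ x, 0 ≤ χ x)
    (hχ1 : ∀ x ∈ tsupport u, χ x = 1) {p : ℝ} (hp : 1 ≤ p) {δ : ℝ} (hδ : 0 < δ) :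
    ((p - 1) * σ + 1) / p * -∫ x in Ω, LV x * regPow u δ p x
      ≤ (p - 1) * (σ - 1) / p * (δ ^ 2) ^ (p / 2) * -(∫ x in Ω, LV x * χ x)
        + p * ∫ x in Ω, V x * (regNormSq u δ x ^ ((p - 1) / 2) * ‖G.subLaplacian u x‖) := by
  have hK := hχ.hasCompactSupport.isCompact
  obtain ⟨v, hv, hvpos, hvσ, ⟨C, hC⟩, hlim⟩ :=
    G.exists_smooth_approx hΩ hK hχ.tsupport_subset hσ hV hVpos hVσ
  have huχ : tsupport u ⊆ tsupport χ := fun x hx => subset_tsupport χ (by simp [hχ1 x hx])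
  have hg := contDiff_regPow hu.contDiff hδ p
  have hgt : IsTestFunction Ω (regPow u δ p) :=
    ⟨hg, hu.hasCompactSupport.mono fun x hx h => hx (regPow_eq_zero h p),
      (tsupport_regPow_subset p).trans hu.tsupport_subset⟩
  have key : ∀ {h : (Fin n → ℝ) → ℝ}, Continuous h → (∀ x ∉ tsupport χ, h x = 0) →
      Tendsto (fun j => ∫ x, v j x * h x) atTop (𝓝 (∫ x in Ω, V x * h x)) := fun hh hs =>
    tendsto_integral_mul hΩ hK hχ.tsupport_subset (fun j => (hv j).continuous)
      (fun j x hx => by rw [abs_of_pos (hvpos j x)]; exact hC j x hx) hlim hh hs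
  have t1 := key (G.contDiff_subLaplacian hg).continuous fun x hx =>
    G.subLaplacian_eq_zero fun h => hx (huχ (tsupport_regPow_subset p h))
  have t2 := key (G.contDiff_subLaplacian hχ.contDiff).continuous fun x hx =>
    G.subLaplacian_eq_zero hx
  have t3 := key (h := fun x => regNormSq u δ x ^ ((p - 1) / 2) * ‖G.subLaplacian u x‖)
    ((contDiff_regNormSq_rpow hu.contDiff hδ _).continuous.mul
      (G.contDiff_subLaplacian hu.contDiff).continuous.norm) fun x hx => by
    rw [G.subLaplacian_eq_zero fun h => hx (huχ h), norm_zero, MulZeroClass.mul_zero]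
  -- The definition of the weak `𝓛V` returns both integrals to the form in which the limit of the
  -- smooth inequalities is taken.
  rw [← hLV.integral_eq _ hgt, ← hLV.integral_eq _ hχ]
  exact le_of_tendsto_of_tendsto' (t1.neg.const_mul _)
    ((t2.neg.const_mul _).add (t3.const_mul p)) fun j =>
      G.integral_regPow_le_of_contDiff hu.contDiff hu.hasCompactSupport hδ hp hσ (hv j) (hvpos j)
        (hvσ j) hχ.contDiff hχ.hasCompactSupport hχ0 hχ1

theorem regNormSq_le {M δ : ℝ} {x : Fin n → ℝ} (hM : ‖u x‖ ≤ M) (hδ0 : 0 ≤ δ) (hδ : δ ≤ 1) :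
    regNormSq u δ x ≤ M ^ 2 + 1 := by
  rw [regNormSq_eq]
  have := norm_nonneg (u x)
  nlinarith

theorem tendsto_regNormSq_rpow {p : ℝ} (hp : 0 ≤ p) (x : Fin n → ℝ) :
    Tendsto (fun j : ℕ => regNormSq u (1 / ((j : ℝ) + 1)) x ^ (p / 2)) atTop (𝓝 (‖u x‖ ^ p)) := by
  have h0 : Tendsto (fun j : ℕ => ‖u x‖ ^ 2 + (1 / ((j : ℝ) + 1)) ^ 2) atTop (𝓝 (‖u x‖ ^ 2)) := by
    simpa using (tendsto_one_div_add_atTop_nhds_zero_nat (𝕜 := ℝ)).pow 2 |>.const_add (‖u x‖ ^ 2)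
  have h1 := h0.rpow_const (p := p / 2) (Or.inr (by positivity))
  have e : (‖u x‖ ^ 2) ^ (p / 2) = ‖u x‖ ^ p := by
    rw [← Real.rpow_natCast, ← Real.rpow_mul (norm_nonneg _), Nat.cast_ofNat,
      mul_div_cancel₀ _ two_ne_zero]
  rw [e] at h1
  simpa only [regNormSq_eq] using h1

/-- The weighted inequality before Hölder's inequality is applied. -/
theorem integral_mul_norm_rpow_le (hΩ : IsOpen Ω) (hσ : 1 < σ)
    (hV : ContinuousOn V Ω) (hVpos : ∀ x ∈ Ω, 0 < V x) (hLV : G.HasWeakSubLaplacian Ω V LV)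
    (hVσ : G.WeakSubLaplacianNonpos Ω (fun x => V x ^ σ)) (hu : IsTestFunction Ω u)
    {p : ℝ} (hp : 1 ≤ p) :
    IntegrableOn (fun x => LV x * ‖u x‖ ^ p) Ω ∧
    IntegrableOn (fun x => V x * (‖u x‖ ^ (p - 1) * ‖G.subLaplacian u x‖)) Ω ∧
    ((p - 1) * σ + 1) / p * -∫ x in Ω, LV x * ‖u x‖ ^ p
      ≤ p * ∫ x in Ω, V x * (‖u x‖ ^ (p - 1) * ‖G.subLaplacian u x‖) := by
  have hp0 : 0 < p := by linarith
  have hK := hu.hasCompactSupport.isCompact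
  set K := tsupport u with hKdef
  obtain ⟨χ, hχ, hχ0, hχ1⟩ := exists_cutoff hΩ hK hu.tsupport_subset
  obtain ⟨M, hM⟩ := hK.exists_bound_of_continuousOn hu.contDiff.continuous.continuousOn
  have hLVK : IntegrableOn LV K :=
    hLV.locallyIntegrableOn.integrableOn_compact_subset hu.tsupport_subset hK
  have hVLu : IntegrableOn (fun x => V x * ‖G.subLaplacian u x‖) K :=
    ((hV.mono hu.tsupport_subset).mul
      (G.contDiff_subLaplacian hu.contDiff).continuous.norm.continuousOn).integrableOn_compact hK
  have toK : ∀ {h : (Fin n → ℝ) → ℝ}, (∀ x ∉ K, h x = 0) → ∫ x in Ω, h x = ∫ x in K, h x :=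
    fun hh => setIntegral_eq_of_subset_of_forall_sdiff_eq_zero hΩ.measurableSet
      hu.tsupport_subset fun x hx => hh x hx.2
  have onΩ : ∀ {h : (Fin n → ℝ) → ℝ}, (∀ x ∉ K, h x = 0) → IntegrableOn h K → IntegrableOn h Ω :=
    fun hh hi => hi.of_forall_sdiff_eq_zero hΩ.measurableSet fun x hx => hh x hx.2
  have zu : ∀ x ∉ K, u x = 0 := fun x hx => image_eq_zero_of_notMem_tsupport hx
  have zL : ∀ x ∉ K, G.subLaplacian u x = 0 := fun x hx => G.subLaplacian_eq_zero hx
  have hup : ∀ {q : ℝ}, 0 ≤ q → Continuous fun x => ‖u x‖ ^ q := fun hq =>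
    hu.contDiff.continuous.norm.rpow_const fun _ => Or.inr hq
  have hδ : ∀ j : ℕ, 0 < 1 / ((j : ℝ) + 1) := fun j => by positivity
  have hδ1 : ∀ j : ℕ, 1 / ((j : ℝ) + 1) ≤ 1 := fun j => by
    rw [div_le_one (by positivity)]
    have : (0 : ℝ) ≤ j := j.cast_nonneg
    linarith
  have tc : Tendsto (fun j : ℕ => ((1 / ((j : ℝ) + 1)) ^ 2) ^ (p / 2)) atTop (𝓝 0) := by
    have := ((tendsto_one_div_add_atTop_nhds_zero_nat (𝕜 := ℝ)).pow 2).rpow_const (p := p / 2)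
      (Or.inr (by positivity))
    rwa [zero_pow two_ne_zero, Real.zero_rpow (by positivity)] at this
  have t1 : Tendsto (fun j : ℕ => ∫ x in Ω, LV x * regPow u (1 / ((j : ℝ) + 1)) p x) atTop
      (𝓝 (∫ x in Ω, LV x * ‖u x‖ ^ p)) := by
    rw [toK fun x hx => by rw [zu x hx, norm_zero, Real.zero_rpow hp0.ne', MulZeroClass.mul_zero]]
    have e : ∀ j : ℕ, ∫ x in Ω, LV x * regPow u (1 / ((j : ℝ) + 1)) p x
        = ∫ x in K, LV x * regPow u (1 / ((j : ℝ) + 1)) p x := fun j =>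
      toK fun x hx => by rw [regPow_eq_zero (zu x hx), MulZeroClass.mul_zero]
    simp only [e]
    refine tendsto_integral_of_dominated_convergence (fun x => ‖LV x‖ * (M ^ 2 + 1) ^ (p / 2))
      (fun j => hLVK.aestronglyMeasurable.mul
        (contDiff_regPow hu.contDiff (hδ j) p).continuous.aestronglyMeasurable)
      (hLVK.norm.mul_const _) (fun j => ?_) ?_
    · filter_upwards [ae_restrict_mem hK.measurableSet] with x hx
      rw [norm_mul]
      gcongr
      rw [Real.norm_of_nonneg (regPow_nonneg hp0.le x)]
      have h1 : regNormSq u (1 / ((j : ℝ) + 1)) x ^ (p / 2) ≤ (M ^ 2 + 1) ^ (p / 2) :=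
        Real.rpow_le_rpow (regNormSq_pos (hδ j) x).le (regNormSq_le (hM x hx) (hδ j).le (hδ1 j))
          (by positivity)
      have h2 : 0 ≤ ((1 / ((j : ℝ) + 1)) ^ 2) ^ (p / 2) := by positivity
      rw [regPow]
      linarith
    · refine Eventually.of_forall fun x => Tendsto.const_mul _ ?_
      have := (tendsto_regNormSq_rpow (u := u) hp0.le x).add tc.neg
      rwa [neg_zero, add_zero] at this
  have t2 : Tendsto (fun j : ℕ => ∫ x in Ω, V x *
        (regNormSq u (1 / ((j : ℝ) + 1)) x ^ ((p - 1) / 2) * ‖G.subLaplacian u x‖)) atTop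
      (𝓝 (∫ x in Ω, V x * (‖u x‖ ^ (p - 1) * ‖G.subLaplacian u x‖))) := by
    -- The vanishing off `K` is taken from `𝓛u`: for `p = 1` the factor `‖u x‖ ^ (p - 1)` is `1`
    -- even where `u` vanishes.
    rw [toK fun x hx => by rw [zL x hx, norm_zero, MulZeroClass.mul_zero, MulZeroClass.mul_zero]]
    have e : ∀ j : ℕ, ∫ x in Ω, V x *
          (regNormSq u (1 / ((j : ℝ) + 1)) x ^ ((p - 1) / 2) * ‖G.subLaplacian u x‖)
        = ∫ x in K, V x *
          (regNormSq u (1 / ((j : ℝ) + 1)) x ^ ((p - 1) / 2) * ‖G.subLaplacian u x‖) := fun j =>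
      toK fun x hx => by rw [zL x hx, norm_zero, MulZeroClass.mul_zero, MulZeroClass.mul_zero]
    simp only [e]
    refine tendsto_integral_of_dominated_convergence
      (fun x => (M ^ 2 + 1) ^ ((p - 1) / 2) * ‖V x * ‖G.subLaplacian u x‖‖)
      (fun j => ?_) (hVLu.norm.const_mul _) (fun j => ?_) ?_
    · exact (((hV.mono hu.tsupport_subset).mul
        ((contDiff_regNormSq_rpow hu.contDiff (hδ j) _).continuous.mul
        (G.contDiff_subLaplacian hu.contDiff).continuous.norm).continuousOn).integrableOn_compact
          hK).aestronglyMeasurable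
    · filter_upwards [ae_restrict_mem hK.measurableSet] with x hx
      have h1 : regNormSq u (1 / ((j : ℝ) + 1)) x ^ ((p - 1) / 2) ≤ (M ^ 2 + 1) ^ ((p - 1) / 2) :=
        Real.rpow_le_rpow (regNormSq_pos (hδ j) x).le (regNormSq_le (hM x hx) (hδ j).le (hδ1 j))
          (div_nonneg (by linarith) two_pos.le)
      have h2 : 0 ≤ regNormSq u (1 / ((j : ℝ) + 1)) x ^ ((p - 1) / 2) :=
        Real.rpow_nonneg (regNormSq_pos (hδ j) x).le _
      calc _ = regNormSq u (1 / ((j : ℝ) + 1)) x ^ ((p - 1) / 2)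
            * ‖V x * ‖G.subLaplacian u x‖‖ := by
            rw [norm_mul, norm_mul, norm_mul, Real.norm_of_nonneg h2]
            ring
        _ ≤ _ := by gcongr
    · exact Eventually.of_forall fun x => Tendsto.const_mul _
        ((tendsto_regNormSq_rpow (by linarith) x).mul_const _)
  refine ⟨onΩ (fun x hx => ?_) (hLVK.mul_continuousOn (hup hp0.le).continuousOn hK),
    onΩ (fun x hx => ?_) ((hV.mono hu.tsupport_subset).mul ((hup (by linarith)).mul
      (G.contDiff_subLaplacian hu.contDiff).continuous.norm).continuousOn |>.integrableOn_compact
        hK), ?_⟩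
  · rw [zu x hx, norm_zero, Real.zero_rpow hp0.ne', MulZeroClass.mul_zero]
  · rw [zL x hx, norm_zero, MulZeroClass.mul_zero, MulZeroClass.mul_zero]
  -- The integral against `χ` does not depend on `δ`, so the cutoff error disappears with `δ ^ p`.
  · have tR := ((tc.const_mul ((p - 1) * (σ - 1) / p)).mul_const (-(∫ x in Ω, LV x * χ x))).add
      (t2.const_mul p)
    rw [MulZeroClass.mul_zero, MulZeroClass.zero_mul, zero_add] at tR
    exact le_of_tendsto_of_tendsto' (t1.neg.const_mul _) tR fun j =>
      G.integral_regPow_le hΩ hσ hV hVpos hLV hVσ hu hχ hχ0 hχ1 hp (hδ j)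

end CarnotGroup

/-! ### The inequality between the norms. -/

theorem theorem3p4 {n : ℕ} (G : CarnotGroup n) (Ω : Set (Fin n → ℝ)) (hΩ : IsOpen Ω)
    (V LV : (Fin n → ℝ) → ℝ) (σ : ℝ) (hσ : 1 < σ)
    (hV : ContinuousOn V Ω) (hVpos : ∀ x ∈ Ω, 0 < V x)
    (hLV : G.HasWeakSubLaplacian Ω V LV) (hLVneg : ∀ᵐ x ∂(volume.restrict Ω), LV x < 0)
    (hVσ : G.WeakSubLaplacianNonpos Ω (fun x => V x ^ σ))
    (u : (Fin n → ℝ) → ℂ) (hu : IsTestFunction Ω u) (p : ℝ) (hp : 1 ≤ p) :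
    eLpNorm (fun x => ((|LV x| ^ (1 / p) : ℝ) : ℂ) * u x) (ENNReal.ofReal p) (volume.restrict Ω) ≤
      ENNReal.ofReal (p ^ 2 / ((p - 1) * σ + 1)) *
        eLpNorm (fun x => ((V x / |LV x| ^ ((p - 1) / p) : ℝ) : ℂ) * G.subLaplacian u x)
          (ENNReal.ofReal p) (volume.restrict Ω) := by
  have hp0 : 0 < p := by linarith
  obtain ⟨hi1, hi2, hmain⟩ := G.integral_mul_norm_rpow_le hΩ hσ hV hVpos hLV hVσ hu hp
  set μ := volume.restrict Ω with hμ
  have hpt : (ENNReal.ofReal p).toReal = p := ENNReal.toReal_ofReal hp0.le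
  have hVp : ∀ᵐ x ∂μ, 0 < V x := by
    filter_upwards [ae_restrict_mem hΩ.measurableSet] with x hx using hVpos x hx
  have hLu := (G.contDiff_subLaplacian hu.contDiff).continuous
  rw [eLpNorm_eq_lintegral_rpow_enorm_toReal (by simpa using hp0) ENNReal.ofReal_ne_top,
    eLpNorm_eq_lintegral_rpow_enorm_toReal (by simpa using hp0) ENNReal.ofReal_ne_top, hpt]
  have eL : ∫⁻ x, ‖((|LV x| ^ (1 / p) : ℝ) : ℂ) * u x‖ₑ ^ p ∂μ
      = ∫⁻ x, ENNReal.ofReal (|LV x| * ‖u x‖ ^ p) ∂μ := by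
    refine lintegral_congr fun x => ?_
    rw [← ofReal_norm, ENNReal.ofReal_rpow_of_nonneg (norm_nonneg _) hp0.le, norm_mul,
      Complex.norm_real, Real.norm_of_nonneg (by positivity),
      Real.mul_rpow (by positivity) (by positivity), ← Real.rpow_mul (abs_nonneg _),
      one_div_mul_cancel hp0.ne', Real.rpow_one]
  have eR : ∫⁻ x, ‖((V x / |LV x| ^ ((p - 1) / p) : ℝ) : ℂ) * G.subLaplacian u x‖ₑ ^ p ∂μ
      = ∫⁻ x, ENNReal.ofReal ((V x * ‖G.subLaplacian u x‖ / |LV x| ^ ((p - 1) / p)) ^ p) ∂μ := by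
    refine lintegral_congr_ae ?_
    filter_upwards [hVp] with x hx
    rw [← ofReal_norm, ENNReal.ofReal_rpow_of_nonneg (norm_nonneg _) hp0.le, norm_mul,
      Complex.norm_real, Real.norm_of_nonneg (by positivity), div_mul_eq_mul_div]
  rw [eL, eR]
  have hH := lintegral_mul_rpow_le (μ := μ) hp (a := fun x => |LV x|) (b := fun x => ‖u x‖)
    (c := fun x => V x * ‖G.subLaplacian u x‖)
    (hLV.locallyIntegrableOn.aestronglyMeasurable.aemeasurable.abs)
    hu.contDiff.continuous.norm.aemeasurable
    ((hV.aemeasurable hΩ.measurableSet).mul hLu.norm.aemeasurable)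
    (by filter_upwards [hLVneg] with x hx using abs_pos.2 hx.ne) (fun x => norm_nonneg _)
    (by filter_upwards [hVp] with x hx using by positivity)
  have hae : (fun x => |LV x| * ‖u x‖ ^ p) =ᵐ[μ] fun x => -(LV x * ‖u x‖ ^ p) := by
    filter_upwards [hLVneg] with x hx
    rw [abs_of_neg hx, neg_mul]
  have hI : ∫⁻ x, ENNReal.ofReal (|LV x| * ‖u x‖ ^ p) ∂μ
      = ENNReal.ofReal (-∫ x, LV x * ‖u x‖ ^ p ∂μ) := by
    rw [← integral_neg, ← integral_congr_ae hae, ← ofReal_integral_eq_lintegral_ofReal]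
    · exact (Integrable.fun_neg hi1).congr hae.symm
    · exact Eventually.of_forall fun x => by positivity
  have hJ : ∫⁻ x, ENNReal.ofReal (V x * ‖G.subLaplacian u x‖ * ‖u x‖ ^ (p - 1)) ∂μ
      = ENNReal.ofReal (∫ x, V x * (‖u x‖ ^ (p - 1) * ‖G.subLaplacian u x‖) ∂μ) := by
    rw [ofReal_integral_eq_lintegral_ofReal hi2]
    · refine lintegral_congr fun x => ?_
      ring_nf
    · filter_upwards [hVp] with x hx
      simp only [Pi.zero_apply]
      positivity
  -- Finiteness of `∫ |𝓛V| |u| ^ p` permits the division even if the right-hand norm is infinite; it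
  -- remains to compare the two Bochner integrals in `hmain`.
  refine ENNReal.rpow_inv_le_of_le_mul_rpow hp (by rw [hI]; exact ENNReal.ofReal_ne_top) ?_
  refine le_trans ?_ (mul_le_mul_right hH _)
  have hden : 0 < (p - 1) * σ + 1 := by nlinarith
  rw [hI, hJ, ← ENNReal.ofReal_mul (by positivity)]
  refine ENNReal.ofReal_le_ofReal ?_
  rw [div_mul_eq_mul_div, div_le_iff₀ hp0] at hmain
  rw [div_mul_eq_mul_div, le_div_iff₀ hden]
  linarith
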